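/- Let $1\le C\le N$ be integers. Files $x_1,x_2,\ldots\in[N]$ are requested one at a time; before each request a prefetcher places $C$ files in a cache, and a request is a hit if the requested file is in the cache. **Sage.** Let $R(i)$ be the number of past requests of file $i$, let $\eta>0$ be a learning rate and $w(i)=e^{\eta R(i)}$. Sage samples $C$ files by Madow's systematic sampling with inclusion probabilities $p(i)=w(i)\,e_{C-1}(w_{-i})/e_C(w)$, where $e_j$ is the elementary symmetric polynomial of order $j$ and $w_{-i}$ is $w$ without its $i$-th entry. The learning rate is tuned adaptively: at each round it is $\eta=\rho(l)$, where $l$ is the number of misses that the best fixed set of $C$ files has on the past requests and $\rho:\mathbb N\to(0,\infty)$ is a tuning rule. **The LZ prefetcher.** Start with a tree consisting of a root and $N$ leaves, positioned at the root. On each request move to the child labelled by the requested file; if that child is a leaf, make it an internal node with $N$ new leaves as children and return to the root. Every internal node runs its own copy of Sage, which is used, and sees the request, exactly at the rounds spent at that node. Let $c(T)$ be the number of internal nodes after $T$ requests (the root and one node per completed phrase), let $\pi^{\mathrm{LZ}}$ be the expected fraction of hits among the first $T$ requests, and let $L_T^{*,\mathrm{LZ}}$ be the least number of misses in the first $T$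 rounds of an offline prefetcher that follows the same growing tree and caches a fixed set of $C$ files at each node. **The benchmark.** A $k$-th order Markov prefetcher caches a set of $C$ files that depends only on the $k$ previous requests (with an arbitrary initial $k$-tuple in place of requests before the first). Let $\tilde\mu_k$ be the largest fraction of hits of such a prefetcher, chosen in hindsight, on the first $T$ requests. **Theorem.** (a) For all $1\le C\le N$ there is a tuning rule $\rho$, depending only on $N$ and $C$, such that for every request sequence and all integers $T,k\ge 0$, $$T(\tilde\mu_k-\pi^{\mathrm{LZ}})\le \delta\big(c(T),L_T^{*,\mathrm{LZ}}\big)+k\,c(T),\qquad \delta(B,L)=\sqrt{2BCL\ln(Ne/C)}+CB\ln(Ne/C).$$ (b) There is an absolute constant $A>0$ such that for all $N\ge2$, all $T\ge2$ and every request sequence, $c(T)\le A\,\dfrac{T\log N}{\log T}$. -/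

import Mathlib

noncomputable section

namespace UniversalCaching

/-! Files are the elements of `Fin N`, a request sequence is `x : ℕ → Fin N` (rounds are numbered
from `0`, so the first `T` requests are `x 0, …, x (T - 1)`), and `C` is the cache capacity. -/

/-! ### Offline prefetchers driven by a sequence of states -/

/-- Number of cache hits in the first `T` rounds of the prefetcher that caches the set `f a`
whenever the current state is `a`, where `s t` is the state at round `t`. -/
def hitCount {N : ℕ} {σ : Type*} (s : ℕ → σ) (f : σ → Finset (Fin N)) (x : ℕ → Fin N) (T : ℕ) :
    ℕ :=
  ((Finset.range T).filter (fun t => x t ∈ f (s t))).card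

/-- Number of cache misses in the first `T` rounds of the same prefetcher. -/
def missCount {N : ℕ} {σ : Type*} (s : ℕ → σ) (f : σ → Finset (Fin N)) (x : ℕ → Fin N) (T : ℕ) :
    ℕ :=
  ((Finset.range T).filter (fun t => x t ∉ f (s t))).card

/-- Least number of cache misses in the first `T` rounds over all offline prefetchers that see the
state sequence `s` and cache, in every state, a fixed set of exactly `C` files. -/
def bestMissCount {N : ℕ} {σ : Type*} (C : ℕ) (s : ℕ → σ) (x : ℕ → Fin N) (T : ℕ) : ℕ :=
  sInf {m | ∃ f : σ → Finset (Fin N), (∀ a, (f a).card = C) ∧ m = missCount s f x T}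

/-! ### Finite state machines and Markov prefetchers -/

/-- A state machine reading file requests: transition function and initial state. -/
structure FSM (N : ℕ) (σ : Type*) where
  next : σ → Fin N → σ
  init : σ

/-- The state of the machine at round `t`, before the request `x t` is seen. -/
def FSM.state {N : ℕ} {σ : Type*} (M : FSM N σ) (x : ℕ → Fin N) : ℕ → σ
  | 0 => M.init
  | t + 1 => M.next (M.state x t) (x t)

/-- The `k`-th order Markov machine: its state is the tuple of the `k` previous requests, most
recent first; the initial tuple `s₀` stands in for the requests before round `0`. -/
def markovFSM (N k : ℕ) (s₀ : Fin k → Fin N) : FSM N (Fin k → Fin N) where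
  next s y := fun j => if j.val = 0 then y else s ⟨j.val - 1, by omega⟩
  init := s₀

/-- The largest number of hits of a `k`-th order Markov prefetcher in the first `T` rounds. -/
def bestMarkovHits {N : ℕ} (C k : ℕ) (x : ℕ → Fin N) (T : ℕ) : ℕ :=
  sSup {h | ∃ (s₀ : Fin k → Fin N) (f : (Fin k → Fin N) → Finset (Fin N)),
    (∀ a, (f a).card = C) ∧ h = hitCount ((markovFSM N k s₀).state x) f x T}

/-- The hit rate of the best offline `k`-th order Markov prefetcher. -/
def markovHitRate {N : ℕ} (C k : ℕ) (x : ℕ → Fin N) (T : ℕ) : ℝ :=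
  (bestMarkovHits C k x T : ℝ) / T

/-! ### The Sage policy -/

/-- Elementary symmetric polynomial of order `k` in the variables `w i`, `i ∈ A`. -/
def esp {N : ℕ} (A : Finset (Fin N)) (k : ℕ) (w : Fin N → ℝ) : ℝ :=
  ∑ S ∈ A.powersetCard k, ∏ j ∈ S, w j

/-- The inclusion probability of file `i` when file `j` was requested `R j` times so far and the
learning rate is `η`; it is the marginal of the Hedge distribution
`p(S) ∝ exp (η * ∑ j ∈ S, R j)` on the sets `S` of `C` files. -/
def sageMarginal {N : ℕ} (C : ℕ) (η : ℝ) (R : Fin N → ℕ) (i : Fin N) : ℝ :=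
  Real.exp (η * R i) * esp (Finset.univ.erase i) (C - 1) (fun j => Real.exp (η * R j)) /
    esp Finset.univ C (fun j => Real.exp (η * R j))

/-- Madow's systematic sampling: the set of files sampled from the marginals `p` when the uniform
random number drawn from `[0, 1)` is `u`. File `j` is selected if one of `u, u + 1, …, u + (C - 1)`
lies between consecutive partial sums `p 0 + ⋯ + p (j - 1)` and `p 0 + ⋯ + p j`. -/
def madowSample {N : ℕ} (C : ℕ) (p : Fin N → ℝ) (u : ℝ) : Set (Fin N) :=
  {j | ∃ i : ℕ, i < C ∧ ∑ l ∈ Finset.Iio j, p l ≤ u + i ∧ u + i < ∑ l ∈ Finset.Iic j, p l}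

/-- Number of misses, on requests with frequencies `R`, of the best fixed set of `C` files. -/
def staticMisses {N : ℕ} (C : ℕ) (R : Fin N → ℕ) : ℕ :=
  ∑ i, R i - (Finset.univ.powersetCard C).sup (fun S => ∑ i ∈ S, R i)

/-- The probability that Sage has file `i` in the cache, when the past requests have frequencies
`R`. Its learning rate is tuned adaptively by the rule `rate`, from the number of misses that the
best fixed set of `C` files has on the past requests. -/
def sageHitProb {N : ℕ} (C : ℕ) (rate : ℕ → ℝ) (R : Fin N → ℕ) (i : Fin N) : ℝ :=
  MeasureTheory.volume.real
    {u : ℝ | u ∈ Set.Ico (0 : ℝ) 1 ∧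
      i ∈ madowSample C (sageMarginal C (rate (staticMisses C R)) R) u}

/-- How often file `i` was requested before round `t` at rounds whose state was `a`. -/
def stateCounts {N : ℕ} {σ : Type*} [DecidableEq σ] (s : ℕ → σ) (x : ℕ → Fin N) (t : ℕ) (a : σ)
    (i : Fin N) : ℕ :=
  ((Finset.range t).filter (fun τ => s τ = a ∧ x τ = i)).card

/-- Expected number of hits in the first `T` rounds when each state runs its own copy of Sage, which
is used, and sees the request, exactly at the rounds spent in that state. -/
def sageExpectedHits {N : ℕ} {σ : Type*} [DecidableEq σ] (C : ℕ) (rate : ℕ → ℝ) (s : ℕ → σ)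
    (x : ℕ → Fin N) (T : ℕ) : ℝ :=
  ∑ t ∈ Finset.range T, sageHitProb C rate (stateCounts s x t (s t)) (x t)

/-! ### The Lempel–Ziv parse tree -/

/-- An `N`-ary parse tree with a current position. A node is the string of requests that leads to it
from the root `[]`. The leaves are the children `a ++ [i]` of internal nodes `a` that are not
internal themselves. -/
structure LZTree (N : ℕ) where
  internal : Finset (List (Fin N))
  current : List (Fin N)

/-- Start with the root and `N` leaves. On a request, descend to the corresponding child; if that
is a leaf, make it internal, with `N` new leaves below it, and return to the root. -/
def lzFSM (N : ℕ) : FSM N (LZTree N) where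
  next τ y :=
    if τ.current ++ [y] ∈ τ.internal then ⟨τ.internal, τ.current ++ [y]⟩
    else ⟨insert (τ.current ++ [y]) τ.internal, []⟩
  init := ⟨{[]}, []⟩

/-- The node of the parse tree at which the request of round `t` is made. -/
def lzNode {N : ℕ} (x : ℕ → Fin N) (t : ℕ) : List (Fin N) :=
  ((lzFSM N).state x t).current

/-- The number of (internal) nodes of the tree after `T` requests: these are the nodes at which
files are prefetched, one for the root and one for every completed phrase. -/
def lzNodeCount {N : ℕ} (x : ℕ → Fin N) (T : ℕ) : ℕ :=
  ((lzFSM N).state x T).internal.card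

/-- Expected hit rate of the LZ prefetcher, which runs a copy of Sage at each node. -/
def lzHitRate {N : ℕ} (C : ℕ) (rate : ℕ → ℝ) (x : ℕ → Fin N) (T : ℕ) : ℝ :=
  sageExpectedHits C rate (lzNode x) x T / T

/-- Number of misses of the optimal offline prefetcher that follows the same growing tree. -/
def lzBestMisses {N : ℕ} (C : ℕ) (x : ℕ → Fin N) (T : ℕ) : ℕ :=
  bestMissCount C (lzNode x) x T

/-- The regret term `δ(B, L) = √(2 B C L ln (N e / C)) + C B ln (N e / C)`. -/
def regretTerm (N C : ℕ) (B L : ℝ) : ℝ :=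
  Real.sqrt (2 * B * C * L * Real.log (N * Real.exp 1 / C)) +
    C * B * Real.log (N * Real.exp 1 / C)

end UniversalCaching

end

open UniversalCaching

/-! Part (a) splits into a comparison of offline prefetchers and a regret bound. A tree node of
depth at least `k` determines the last `k` requests, so there the tree can imitate any Markov
prefetcher. Each phrase has at most `k` shallower rounds, which costs `k * c(T)`
(`bestMarkovHits_le`).

Regret: Madow sampling realises the marginals exactly, so Sage is Hedge over `C`-sets. Put `D = C *
log (N * e / C)`, `lam = log (N.choose C)`, `κ = lossFactor η = 1 / (1 - exp (-η))`, let `l` be the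
misses of the best fixed set, and let `X` (`logExcess`) be the log-partition function minus `η`
times the hits of that set; `0 ≤ X ≤ lam`. The potential `l + b(l) - κ * X`, with `η` the rate at
`l` and `b = sageRegretBound`, grows in each round by at least Sage's loss
(`one_sub_sageMarginal_le`). If the best set gains a hit, this is the usual Hedge inequality. If it
does not, the requested file is at most as frequent afterwards as `C` others, so its new marginal is
at most `C / (C + 1)`. This restricts the mix gap enough for the growth of `b` to cover it together
with the change of rate (`sageRegretBound_step`).

The result is `b(l) ≤ (C + 1) * D + √(2 * (C + 1)) * √(D * l)`, and `b(0) ≤ D`. A node with a static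
miss has seen more than `C` distinct files, and every visited node at least one, so both bounds have
the form `n * D + √(2 * n) * √(D * l)` with `n` the number of distinct files seen there. Each pair
of a node and a file requested there is an internal node of the tree, so these `n` sum to at most
`c(T)`, and Cauchy–Schwarz gives `δ` with the stated constants (`lz_regret_le`).

Part (b): at most `2 * N ^ d` nodes have depth at most `d`, and the depths sum to at most `T`, so at
most `T / (d + 1)` nodes are deeper. Take `N ^ d` of order at most `√T`. -/

namespace UniversalCaching

/-! ### The Lempel–Ziv parse tree -/

section ParseTree

variable {N : ℕ} (x : ℕ → Fin N)

/-- The internal nodes of the parse tree before round `t`. -/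
def lzInternal (t : ℕ) : Finset (List (Fin N)) := ((lzFSM N).state x t).internal

theorem lzNode_succ (t : ℕ) :
    lzNode x (t + 1) =
      if lzNode x t ++ [x t] ∈ lzInternal x t then lzNode x t ++ [x t] else [] :=
  apply_ite LZTree.current _ _ _

theorem lzInternal_succ (t : ℕ) :
    lzInternal x (t + 1) =
      if lzNode x t ++ [x t] ∈ lzInternal x t then lzInternal x t
      else insert (lzNode x t ++ [x t]) (lzInternal x t) :=
  apply_ite LZTree.internal _ _ _

theorem lzInternal_mono : Monotone (lzInternal x) := by
  refine monotone_nat_of_le_succ fun t => ?_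
  rw [lzInternal_succ]
  split_ifs
  · exact le_rfl
  · exact Finset.subset_insert _ _

theorem lzNode_append_mem {t T : ℕ} (h : t < T) : lzNode x t ++ [x t] ∈ lzInternal x T := by
  refine lzInternal_mono x (Nat.succ_le_of_lt h) ?_
  rw [Nat.succ_eq_add_one, lzInternal_succ]
  split_ifs with h'
  · exact h'
  · exact Finset.mem_insert_self _ _

/-- A phrase lasts as many rounds as the depth of the node it creates; the last summand counts the
rounds of the unfinished phrase. -/
theorem sum_length_lzInternal (T : ℕ) :
    ∑ a ∈ lzInternal x T, a.length + (lzNode x T).length = T := by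
  induction T with
  | zero => simp [lzInternal, lzNode, FSM.state, lzFSM]
  | succ t ih =>
    rw [lzInternal_succ, lzNode_succ]
    split_ifs with h
    · rw [List.length_append, List.length_singleton, ← add_assoc, ih]
    · rw [Finset.sum_insert h, List.length_append, List.length_singleton, List.length_nil]
      omega

/-- The truncated difference is the number of shallow rounds the current phrase may still use.
Adding it makes the bound inductive: a new phrase raises both sides by the same budget `k`. -/
theorem card_depth_lt_add (k T : ℕ) :
    ((Finset.range T).filter (fun t => (lzNode x t).length < k)).card
      + (k - (lzNode x T).length) ≤ k * (lzInternal x T).card := by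
  induction T with
  | zero =>
    rw [Finset.range_zero, Finset.filter_empty]
    simp [lzInternal, lzNode, FSM.state, lzFSM]
  | succ t ih =>
    rw [Finset.range_add_one, Finset.filter_insert, lzInternal_succ, lzNode_succ]
    have hc : t ∉ (Finset.range t).filter (fun t => (lzNode x t).length < k) := by simp
    split_ifs with h1 h2 h2
    · rw [Finset.card_insert_of_notMem hc, List.length_append, List.length_singleton]
      omega
    · rw [Finset.card_insert_of_notMem hc, Finset.card_insert_of_notMem h2, List.length_nil,
        mul_add]
      omega
    · rw [List.length_append, List.length_singleton]
      omega
    · rw [Finset.card_insert_of_notMem h2, List.length_nil, mul_add]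
      omega

theorem card_depth_lt_le (k T : ℕ) :
    ((Finset.range T).filter (fun t => (lzNode x t).length < k)).card ≤ k * lzNodeCount x T :=
  (Nat.le_add_right _ _).trans (card_depth_lt_add x k T)

/-- Each file requested at a node of the tree gives rise to an internal child of that node. -/
theorem sum_card_requested_le_lzNodeCount (T : ℕ) (A : Finset (List (Fin N))) :
    ∑ a ∈ A, (Finset.univ.filter
      (fun i => ∃ t < T, lzNode x t = a ∧ x t = i)).card ≤ lzNodeCount x T := by
  rw [← Finset.card_sigma]
  refine Finset.card_le_card_of_injOn (fun p => p.1 ++ [p.2]) ?_ ?_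
  · rintro ⟨a, i⟩ h
    simp only [Finset.coe_sigma, Set.mem_sigma_iff, Finset.coe_filter, Set.mem_ofPred_eq] at h
    obtain ⟨-, -, t, ht, rfl, rfl⟩ := h
    exact lzNode_append_mem x ht
  · rintro ⟨a, i⟩ - ⟨b, j⟩ - h
    have h' := List.append_inj' h rfl
    simp only [List.cons.injEq, and_true] at h'
    obtain ⟨rfl, rfl⟩ := h'
    rfl

/-! ### Markov prefetchers and the parse tree -/

theorem markov_state_eq_lzNode {k : ℕ} (s₀ : Fin k → Fin N) (t : ℕ) (j : Fin k)
    (hj : j.val < (lzNode x t).length) :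
    (markovFSM N k s₀).state x t j = (lzNode x t).reverse.getD j.val (x 0) := by
  induction t generalizing j with
  | zero => simp [lzNode, FSM.state, lzFSM] at hj
  | succ t ih =>
    rw [lzNode_succ] at hj ⊢
    split_ifs at hj ⊢ with h
    · rw [List.length_append, List.length_singleton] at hj
      rw [List.reverse_append, List.reverse_singleton, List.singleton_append]
      obtain ⟨j, hk⟩ := j
      cases j with
      | zero => simp [FSM.state, markovFSM]
      | succ j =>
        rw [List.getD_cons_succ]
        exact ih ⟨j, by omega⟩ (by simpa using hj)
    · simp at hj

theorem hitCount_add_missCount {σ : Type*} (s : ℕ → σ) (f : σ → Finset (Fin N)) (T : ℕ) :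
    hitCount s f x T + missCount s f x T = T := by
  simpa [hitCount, missCount] using
    Finset.card_filter_add_card_filter_not (s := Finset.range T) (fun t => x t ∈ f (s t))

theorem bestMissCount_le {σ : Type*} {C : ℕ} (s : ℕ → σ) (T : ℕ) (f : σ → Finset (Fin N))
    (hf : ∀ a, (f a).card = C) : bestMissCount C s x T ≤ missCount s f x T :=
  Nat.sInf_le ⟨f, hf, rfl⟩

theorem exists_bestMissCount {σ : Type*} {C : ℕ} (hC : C ≤ N) (s : ℕ → σ) (T : ℕ) :
    ∃ f : σ → Finset (Fin N), (∀ a, (f a).card = C) ∧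
      bestMissCount C s x T = missCount s f x T := by
  obtain ⟨S, -, hS⟩ := Finset.exists_subset_card_eq (s := (Finset.univ : Finset (Fin N)))
    (n := C) (by simpa using hC)
  exact Nat.sInf_mem
    (s := {m | ∃ f : σ → Finset (Fin N), (∀ a, (f a).card = C) ∧ m = missCount s f x T})
    ⟨_, fun _ => S, fun _ => hS, rfl⟩

theorem markov_hitCount_le {C k : ℕ} (s₀ : Fin k → Fin N) (f : (Fin k → Fin N) → Finset (Fin N))
    (hf : ∀ a, (f a).card = C) (T : ℕ) :
    hitCount ((markovFSM N k s₀).state x) f x T + lzBestMisses C x T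
      ≤ T + k * lzNodeCount x T := by
  -- The node, read backwards, supplies the Markov tuple; the padding `x 0` matters only at depth
  -- less than `k`.
  let g : List (Fin N) → Finset (Fin N) := fun a => f fun j => a.reverse.getD j.val (x 0)
  have h1 := bestMissCount_le x (lzNode x) T g (fun a => hf _)
  have h2 := hitCount_add_missCount x (lzNode x) g T
  have h3 := card_depth_lt_le x k T
  have h4 : hitCount ((markovFSM N k s₀).state x) f x T ≤ hitCount (lzNode x) g x T
      + ((Finset.range T).filter (fun t => (lzNode x t).length < k)).card := by
    refine (Finset.card_le_card ?_).trans (Finset.card_union_le _ _)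
    intro t ht
    rw [Finset.mem_filter] at ht
    rw [Finset.mem_union, Finset.mem_filter, Finset.mem_filter]
    by_cases hk : (lzNode x t).length < k
    · exact Or.inr ⟨ht.1, hk⟩
    · refine Or.inl ⟨ht.1, ?_⟩
      have : (markovFSM N k s₀).state x t = fun j => (lzNode x t).reverse.getD j.val (x 0) :=
        funext fun j => markov_state_eq_lzNode x s₀ t j (by omega)
      simpa only [g, this] using ht.2
  unfold lzBestMisses
  omega

theorem bestMarkovHits_le {C : ℕ} (hC : C ≤ N) (k T : ℕ) :
    bestMarkovHits C k x T + lzBestMisses C x T ≤ T + k * lzNodeCount x T := by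
  obtain ⟨S, -, hS⟩ := Finset.exists_subset_card_eq (s := (Finset.univ : Finset (Fin N)))
    (n := C) (by simpa using hC)
  obtain ⟨s₀, f, hf, h⟩ := Nat.sSup_mem
    (s := {h | ∃ (s₀ : Fin k → Fin N) (f : (Fin k → Fin N) → Finset (Fin N)),
      (∀ a, (f a).card = C) ∧ h = hitCount ((markovFSM N k s₀).state x) f x T})
    ⟨_, fun _ => x 0, fun _ => S, fun _ => hS, rfl⟩
    ⟨T, by
      rintro _ ⟨s₀, f, -, rfl⟩
      exact (Nat.le_add_right _ _).trans (hitCount_add_missCount x _ f T).le⟩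
  rw [bestMarkovHits, h]
  exact markov_hitCount_le x s₀ f hf T

end ParseTree

/-! ### The size of the parse tree -/

theorem card_filter_length_le {α : Type*} [Fintype α] [DecidableEq α]
    (hα : 2 ≤ Fintype.card α) (A : Finset (List α)) (d : ℕ) :
    (A.filter (fun a => a.length ≤ d)).card + 1 ≤ 2 * Fintype.card α ^ d := by
  induction d generalizing A with
  | zero =>
    have : (A.filter (fun a => a.length ≤ 0)).card ≤ 1 :=
      Finset.card_le_one.2 fun a ha b hb => by
        simp only [nonpos_iff_eq_zero, List.length_eq_zero_iff, Finset.mem_filter] at ha hb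
        rw [ha.2, hb.2]
    simpa using this
  | succ d ih =>
    let B : Finset (List α) := (A.image List.tail).filter (fun a => a.length ≤ d)
    have hsub : A.filter (fun a => a.length ≤ d + 1) ⊆
        insert [] ((Finset.univ ×ˢ B).image fun p : α × List α => p.1 :: p.2) := by
      intro a ha
      rw [Finset.mem_filter] at ha
      cases a with
      | nil => exact Finset.mem_insert_self _ _
      | cons i a =>
        refine Finset.mem_insert_of_mem (Finset.mem_image.2 ⟨(i, a), ?_, rfl⟩)
        simp only [B, Finset.mem_product, Finset.mem_univ, true_and, Finset.mem_filter,
          Finset.mem_image]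
        exact ⟨⟨_, ha.1, rfl⟩, by simpa using ha.2⟩
    have h1 := (Finset.card_le_card hsub).trans (Finset.card_insert_le _ _)
    have h2 : ((Finset.univ ×ˢ B).image fun p : α × List α => p.1 :: p.2).card
        ≤ Fintype.card α * B.card := by
      refine Finset.card_image_le.trans ?_
      rw [Finset.card_product, Finset.card_univ]
    have h3 := Nat.mul_le_mul_left (Fintype.card α) (ih (A.image List.tail))
    change Fintype.card α * (B.card + 1) ≤ _ at h3
    rw [pow_succ]
    nlinarith

theorem lzNodeCount_le_of_depth {N : ℕ} (hN : 2 ≤ N) (x : ℕ → Fin N) (T d : ℕ) :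
    (lzNodeCount x T : ℝ) ≤ 2 * (N : ℝ) ^ d + T / (d + 1) := by
  have h1 := card_filter_length_le (α := Fin N) (by simpa using hN) (lzInternal x T) d
  have h2 : (lzInternal x T).card = _ :=
    (Finset.card_filter_add_card_filter_not (s := lzInternal x T) (fun a => a.length ≤ d)).symm
  have h3 : ((lzInternal x T).filter (fun a => ¬ a.length ≤ d)).card * (d + 1) ≤ T := by
    have h := Finset.card_nsmul_le_sum ((lzInternal x T).filter (fun a => ¬ a.length ≤ d))
      (fun a => a.length) (d + 1) fun a ha => not_le.1 (Finset.mem_filter.1 ha).2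
    have h' := Finset.sum_le_sum_of_subset (f := fun a : List (Fin N) => a.length)
      (Finset.filter_subset (fun a => ¬ a.length ≤ d) (lzInternal x T))
    rw [smul_eq_mul] at h
    have := sum_length_lzInternal x T
    omega
  have h4 : (((lzInternal x T).filter (fun a => ¬ a.length ≤ d)).card : ℝ) ≤ T / (d + 1) := by
    rw [le_div_iff₀ (by positivity)]
    exact_mod_cast h3
  have h5 : (((lzInternal x T).filter (fun a => a.length ≤ d)).card : ℝ) ≤ 2 * (N : ℝ) ^ d := by
    rw [Fintype.card_fin] at h1
    exact_mod_cast (Nat.le_add_right _ _).trans h1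
  have h6 : (lzNodeCount x T : ℝ) = _ := congrArg (Nat.cast (R := ℝ)) h2
  rw [h6, Nat.cast_add]
  exact add_le_add h5 h4

theorem lzNodeCount_le {N : ℕ} (hN : 2 ≤ N) (x : ℕ → Fin N) {T : ℕ} (hT : 2 ≤ T) :
    (lzNodeCount x T : ℝ) ≤ 6 * (T * Real.log N / Real.log T) := by
  have hT' : (2 : ℝ) ≤ T := by exact_mod_cast hT
  have hN' : (2 : ℝ) ≤ N := by exact_mod_cast hN
  have hlT : 0 < Real.log T := Real.log_pos (by linarith)
  have hl2 := Real.log_two_gt_d9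
  have hlN : Real.log 2 ≤ Real.log N := Real.log_le_log (by norm_num) hN'
  have hlN0 : 0 < Real.log N := by linarith
  -- Half the depth of a full tree with `T` leaves, so that `N ^ ⌊r⌋₊ ≤ √T`.
  set r : ℝ := Real.log T / (2 * Real.log N) with hr
  have hr0 : 0 < r := by positivity
  have h := lzNodeCount_le_of_depth hN x T ⌊r⌋₊
  have h1 : (N : ℝ) ^ ⌊r⌋₊ ≤ Real.sqrt T := by
    rw [← Real.rpow_natCast, Real.sqrt_eq_rpow, ← Real.log_le_log_iff (by positivity)
      (by positivity), Real.log_rpow (by linarith), Real.log_rpow (by linarith)]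
    calc (⌊r⌋₊ : ℝ) * Real.log N ≤ r * Real.log N := by
          gcongr; exact Nat.floor_le hr0.le
      _ = 1 / 2 * Real.log T := by rw [hr]; field_simp
  have h2 : (T : ℝ) / (⌊r⌋₊ + 1) ≤ 2 * (T * Real.log N / Real.log T) := by
    calc (T : ℝ) / (⌊r⌋₊ + 1) ≤ T / r := by
          gcongr; exact (Nat.lt_floor_add_one r).le
      _ = 2 * (T * Real.log N / Real.log T) := by rw [hr]; field_simp
  have h3 : Real.sqrt T * Real.log T ≤ T := by
    have hs : Real.log T = 2 * Real.log (Real.sqrt T) := by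
      rw [Real.log_sqrt (by linarith)]; ring
    have hs2 : Real.log (Real.sqrt T) ≤ Real.sqrt T / 2 := by
      have hp : 0 < Real.sqrt T := by positivity
      have := Real.add_one_le_exp (Real.log (Real.sqrt T) - Real.log 2)
      rw [Real.exp_sub, Real.exp_log hp, Real.exp_log (by norm_num)] at this
      have h2' := Real.log_two_lt_d9
      linarith
    calc Real.sqrt T * Real.log T ≤ Real.sqrt T * Real.sqrt T := by
          gcongr; linarith
      _ = T := Real.mul_self_sqrt (by linarith)
  have h4 : Real.sqrt T ≤ 2 * (T * Real.log N / Real.log T) := by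
    rw [mul_div_assoc', le_div_iff₀ hlT]
    nlinarith
  linarith

/-! ### Madow's systematic sampling -/

/-- The points `u + i` with `i < C` sweep `[0, C)` exactly once. Cutting the interval of file `j` at
the integers and translating the pieces into `[0, 1)` preserves its length `p j`. -/
theorem madow_inclusion_prob {N C : ℕ} {p : Fin N → ℝ} (h0 : ∀ i, 0 ≤ p i) (h1 : ∀ i, p i ≤ 1)
    (hs : ∑ i, p i = C) (j : Fin N) :
    MeasureTheory.volume.real {u : ℝ | u ∈ Set.Ico (0 : ℝ) 1 ∧ j ∈ madowSample C p u} = p j := by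
  set a : ℝ := ∑ l ∈ Finset.Iio j, p l with ha
  set b : ℝ := ∑ l ∈ Finset.Iic j, p l with hb
  have hab : b = p j + a := by
    rw [hb, ha, ← Finset.Iio_insert, Finset.sum_insert (by simp)]
  have ha0 : 0 ≤ a := Finset.sum_nonneg fun l _ => h0 l
  have hbC : b ≤ C := by
    rw [← hs]
    exact Finset.sum_le_sum_of_subset_of_nonneg (Finset.subset_univ _) fun l _ _ => h0 l
  have hj := h1 j
  let B : ℕ → Set ℝ := fun i => Set.Ico a b ∩ Set.Ico (i : ℝ) (i + 1)
  have hBm : ∀ i, MeasurableSet (B i) := fun i => measurableSet_Ico.inter measurableSet_Ico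
  have hset : {u : ℝ | u ∈ Set.Ico (0 : ℝ) 1 ∧ j ∈ madowSample C p u} =
      ⋃ i ∈ Finset.range C, (fun u : ℝ => u + i) ⁻¹' B i := by
    ext u
    simp only [madowSample, Set.mem_ofPred_eq, Set.mem_iUnion, Finset.mem_range, Set.mem_preimage,
      B, Set.mem_inter_iff, Set.mem_Ico, exists_prop, ← ha, ← hb]
    constructor
    · rintro ⟨⟨hu0, hu1⟩, i, hi, h⟩
      exact ⟨i, hi, h, by linarith, by linarith⟩
    · rintro ⟨i, hi, h, h2, h3⟩
      exact ⟨⟨by linarith, by linarith⟩, i, hi, h⟩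
  have hIco : Set.Ico a b = ⋃ i ∈ Finset.range C, B i := by
    ext u
    simp only [Set.mem_iUnion, Finset.mem_range, B, Set.mem_inter_iff, Set.mem_Ico, exists_prop]
    constructor
    · rintro ⟨hu1, hu2⟩
      have hu0 : 0 ≤ u := ha0.trans hu1
      refine ⟨⌊u⌋₊, ?_, ⟨hu1, hu2⟩, Nat.floor_le hu0, Nat.lt_floor_add_one u⟩
      rw [Nat.floor_lt hu0]
      exact hu2.trans_le hbC
    · rintro ⟨i, -, h, -⟩
      exact h
  have hcast : ∀ {i i' : ℕ}, i ≠ i' → (i : ℝ) + 1 ≤ i' ∨ (i' : ℝ) + 1 ≤ i := by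
    intro i i' h
    rcases Nat.lt_or_gt_of_ne h with h | h
    · left; exact_mod_cast h
    · right; exact_mod_cast h
  -- Since `p j ≤ 1`, an interval of this length cannot contain two points `u + i` and `u + i'`.
  have hd1 : Set.PairwiseDisjoint (↑(Finset.range C)) (fun i : ℕ => (fun u : ℝ => u + i) ⁻¹' B i) := by
    intro i _ i' _ hii
    refine Set.disjoint_left.2 fun u hu hu' => ?_
    simp only [Set.mem_preimage, B, Set.mem_inter_iff, Set.mem_Ico] at hu hu'
    rcases hcast hii with h | h <;> linarith [hu.1.1, hu.1.2, hu'.1.1, hu'.1.2]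
  have hd2 : Set.PairwiseDisjoint (↑(Finset.range C)) B := by
    intro i _ i' _ hii
    refine Set.disjoint_left.2 fun u hu hu' => ?_
    simp only [B, Set.mem_inter_iff, Set.mem_Ico] at hu hu'
    rcases hcast hii with h | h <;> linarith [hu.2.1, hu.2.2, hu'.2.1, hu'.2.2]
  have hfin : ∀ i, MeasureTheory.volume (B i) ≠ ⊤ := fun i =>
    ((MeasureTheory.measure_mono Set.inter_subset_left).trans_lt
      (measure_Ico_lt_top (a := a) (b := b))).ne
  have hpre : ∀ i : ℕ, MeasureTheory.volume ((fun u : ℝ => u + i) ⁻¹' B i) =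
      MeasureTheory.volume (B i) := fun i => MeasureTheory.measure_preimage_add_right _ _ _
  rw [hset, MeasureTheory.measureReal_biUnion_finset hd1
    (fun i _ => (hBm i).preimage (measurable_add_const _)) (fun i _ => by rw [hpre]; exact hfin i)]
  simp_rw [MeasureTheory.measureReal_def, hpre, ← MeasureTheory.measureReal_def]
  rw [← MeasureTheory.measureReal_biUnion_finset hd2 (fun i _ => hBm i) (fun i _ => hfin i),
    ← hIco, Real.volume_real_Ico_of_le (by linarith [h0 j])]
  linarith

/-! ### Elementary symmetric polynomials and the marginals of Sage -/

section Marginals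

variable {N : ℕ}

theorem esp_insert {B : Finset (Fin N)} {a : Fin N} (ha : a ∉ B) (n : ℕ) (w : Fin N → ℝ) :
    esp (insert a B) (n + 1) w = esp B (n + 1) w + w a * esp B n w := by
  have hnot : ∀ S ∈ B.powersetCard n, a ∉ S := fun S hS h =>
    ha ((Finset.mem_powersetCard.1 hS).1 h)
  rw [esp, Finset.powersetCard_succ_insert ha, Finset.sum_union, Finset.sum_image, esp, esp,
    Finset.mul_sum]
  · congr 1
    exact Finset.sum_congr rfl fun S hS => Finset.prod_insert (hnot S hS)
  · intro S hS S' hS' h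
    rw [← Finset.erase_insert (hnot S hS), ← Finset.erase_insert (hnot S' hS')]
    exact congrArg (fun s => Finset.erase s a) h
  · refine Finset.disjoint_left.2 fun S hS hS' => ?_
    obtain ⟨S', -, rfl⟩ := Finset.mem_image.1 hS'
    exact ha ((Finset.mem_powersetCard.1 hS).1 (Finset.mem_insert_self _ _))

theorem esp_eq_erase_add {B : Finset (Fin N)} {a : Fin N} (ha : a ∈ B) {n : ℕ} (hn : 1 ≤ n)
    (w : Fin N → ℝ) : esp B n w = esp (B.erase a) n w + w a * esp (B.erase a) (n - 1) w := by
  obtain ⟨n, rfl⟩ := Nat.exists_eq_add_of_le' hn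
  conv_lhs => rw [← Finset.insert_erase ha]
  exact esp_insert (Finset.notMem_erase a B) n w

theorem esp_congr {B : Finset (Fin N)} {w w' : Fin N → ℝ} (h : ∀ i ∈ B, w i = w' i) (n : ℕ) :
    esp B n w = esp B n w' :=
  Finset.sum_congr rfl fun _ hS => Finset.prod_congr rfl fun i hi =>
    h i ((Finset.mem_powersetCard.1 hS).1 hi)

theorem esp_nonneg (B : Finset (Fin N)) (n : ℕ) {w : Fin N → ℝ} (hw : ∀ i, 0 < w i) :
    0 ≤ esp B n w :=
  Finset.sum_nonneg fun _ _ => Finset.prod_nonneg fun i _ => (hw i).le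

/-- The frequencies `R` after one more request of file `i`. -/
def addRequest (R : Fin N → ℕ) (i : Fin N) : Fin N → ℕ := fun j => R j + if j = i then 1 else 0

theorem addRequest_self (R : Fin N → ℕ) (i : Fin N) : addRequest R i i = R i + 1 := by
  simp [addRequest]

theorem addRequest_of_ne (R : Fin N → ℕ) {i j : Fin N} (h : j ≠ i) : addRequest R i j = R j := by
  simp [addRequest, h]

/-- The normalising constant of the Hedge distribution on sets of `C` files. -/
noncomputable def hedgePartition (C : ℕ) (η : ℝ) (R : Fin N → ℕ) : ℝ :=
  esp Finset.univ C fun j => Real.exp (η * R j)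

theorem hedgePartition_eq_sum (C : ℕ) (η : ℝ) (R : Fin N → ℕ) :
    hedgePartition C η R =
      ∑ S ∈ Finset.univ.powersetCard C, Real.exp (η * ((∑ i ∈ S, R i : ℕ) : ℝ)) := by
  rw [hedgePartition, esp]
  refine Finset.sum_congr rfl fun S _ => ?_
  rw [← Real.exp_sum, Nat.cast_sum, Finset.mul_sum]

theorem hedgePartition_pos {C : ℕ} (hC : C ≤ N) (η : ℝ) (R : Fin N → ℕ) :
    0 < hedgePartition C η R := by
  rw [hedgePartition_eq_sum]
  refine Finset.sum_pos (fun _ _ => Real.exp_pos _) ?_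
  rw [Finset.powersetCard_nonempty]
  simpa using hC

theorem sageMarginal_mul_hedgePartition {C : ℕ} (hC : C ≤ N) (η : ℝ) (R : Fin N → ℕ)
    (i : Fin N) : sageMarginal C η R i * hedgePartition C η R =
      Real.exp (η * R i) * esp (Finset.univ.erase i) (C - 1) (fun j => Real.exp (η * R j)) :=
  div_mul_cancel₀ _ (hedgePartition_pos hC η R).ne'

theorem hedgePartition_eq_add {C : ℕ} (hC1 : 1 ≤ C) (η : ℝ) (R : Fin N → ℕ) (i : Fin N) :
    hedgePartition C η R = esp (Finset.univ.erase i) C (fun j => Real.exp (η * R j)) +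
      Real.exp (η * R i) * esp (Finset.univ.erase i) (C - 1) (fun j => Real.exp (η * R j)) :=
  esp_eq_erase_add (Finset.mem_univ i) hC1 _

theorem sageMarginal_nonneg {C : ℕ} (η : ℝ) (R : Fin N → ℕ) (i : Fin N) :
    0 ≤ sageMarginal C η R i :=
  div_nonneg (mul_nonneg (Real.exp_pos _).le (esp_nonneg _ _ fun _ => Real.exp_pos _))
    (esp_nonneg _ _ fun _ => Real.exp_pos _)

theorem sageMarginal_le_one {C : ℕ} (hC1 : 1 ≤ C) (hC : C ≤ N) (η : ℝ) (R : Fin N → ℕ)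
    (i : Fin N) : sageMarginal C η R i ≤ 1 := by
  have h := sageMarginal_mul_hedgePartition hC η R i
  have h2 := hedgePartition_eq_add hC1 η R i
  have h3 := esp_nonneg (Finset.univ.erase i) C (w := fun j => Real.exp (η * R j))
    fun _ => Real.exp_pos _
  exact le_of_mul_le_mul_right (by linarith) (hedgePartition_pos hC η R)

theorem sum_sageMarginal {C : ℕ} (hC1 : 1 ≤ C) (hC : C ≤ N) (η : ℝ) (R : Fin N → ℕ) :
    ∑ i, sageMarginal C η R i = C := by
  have hQ := hedgePartition_pos hC η R
  refine mul_right_cancel₀ hQ.ne' ?_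
  rw [Finset.sum_mul]
  set w : Fin N → ℝ := fun j => Real.exp (η * R j) with hw
  have key : ∀ i, sageMarginal C η R i * hedgePartition C η R =
      ∑ S ∈ Finset.univ.powersetCard C, if i ∈ S then ∏ j ∈ S, w j else 0 := by
    intro i
    have h1 := sageMarginal_mul_hedgePartition hC η R i
    have h2 := hedgePartition_eq_add hC1 η R i
    have h3 : esp (Finset.univ.erase i) C w =
        ∑ S ∈ Finset.univ.powersetCard C, if i ∈ S then 0 else ∏ j ∈ S, w j := by
      simp_rw [← ite_not (_ ∈ _)]
      rw [← Finset.sum_filter, esp]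
      refine Finset.sum_congr ?_ fun _ _ => rfl
      ext S
      simp only [Finset.mem_powersetCard, Finset.mem_filter, Finset.subset_erase,
        Finset.subset_univ, true_and]
      tauto
    have h4 : hedgePartition C η R =
        (∑ S ∈ Finset.univ.powersetCard C, if i ∈ S then ∏ j ∈ S, w j else 0) +
        ∑ S ∈ Finset.univ.powersetCard C, if i ∈ S then 0 else ∏ j ∈ S, w j := by
      rw [← Finset.sum_add_distrib, hedgePartition, esp]
      refine Finset.sum_congr rfl fun S _ => ?_
      split_ifs <;> simp [hw]
    linarith
  simp_rw [key]
  rw [Finset.sum_comm, hedgePartition, esp, Finset.mul_sum]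
  refine Finset.sum_congr rfl fun S hS => ?_
  rw [Finset.sum_ite_mem, Finset.univ_inter, Finset.sum_const, (Finset.mem_powersetCard.1 hS).2,
    nsmul_eq_mul]

theorem sageHitProb_eq {C : ℕ} (hC1 : 1 ≤ C) (hC : C ≤ N) (rate : ℕ → ℝ) (R : Fin N → ℕ)
    (i : Fin N) : sageHitProb C rate R i = sageMarginal C (rate (staticMisses C R)) R i :=
  madow_inclusion_prob (sageMarginal_nonneg _ _) (sageMarginal_le_one hC1 hC _ _)
    (sum_sageMarginal hC1 hC _ _) i

/-- Sets containing both files contribute equally to the two marginals; the others correspond by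
exchanging `i` and `j`. -/
theorem sageMarginal_le_of_le {C : ℕ} (hC : C ≤ N) {η : ℝ} (hη : 0 ≤ η)
    {R : Fin N → ℕ} {i j : Fin N} (h : R i ≤ R j) :
    sageMarginal C η R i ≤ sageMarginal C η R j := by
  rcases eq_or_ne i j with rfl | hij
  · exact le_rfl
  refine le_of_mul_le_mul_right ?_ (hedgePartition_pos hC η R)
  rw [sageMarginal_mul_hedgePartition hC, sageMarginal_mul_hedgePartition hC]
  have hw : Real.exp (η * R i) ≤ Real.exp (η * R j) := by gcongr
  rcases Nat.lt_or_ge 1 C with h2 | h2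
  · have h1' : 1 ≤ C - 1 := by omega
    rw [esp_eq_erase_add (a := j) (Finset.mem_erase.2 ⟨hij.symm, Finset.mem_univ _⟩) h1',
      esp_eq_erase_add (a := i) (B := Finset.univ.erase j)
        (Finset.mem_erase.2 ⟨hij, Finset.mem_univ _⟩) h1', Finset.erase_right_comm]
    have := esp_nonneg ((Finset.univ.erase j).erase i) (C - 1)
      (w := fun j => Real.exp (η * R j)) fun _ => Real.exp_pos _
    nlinarith
  · have h0 : C - 1 = 0 := by omega
    simpa [h0, esp] using hw

theorem hedgePartition_addRequest {C : ℕ} (hC1 : 1 ≤ C) (hC : C ≤ N) (η : ℝ) (R : Fin N → ℕ)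
    (i : Fin N) : hedgePartition C η (addRequest R i) =
      hedgePartition C η R * (1 + sageMarginal C η R i * (Real.exp η - 1)) := by
  have h1 := sageMarginal_mul_hedgePartition hC η R i
  have h2 := hedgePartition_eq_add hC1 η R i
  have h3 := hedgePartition_eq_add hC1 η (addRequest R i) i
  have hc : ∀ j ∈ Finset.univ.erase i, (fun j => Real.exp (η * ((addRequest R i) j : ℕ))) j =
      (fun j => Real.exp (η * R j)) j := fun j hj => by
    simp only [addRequest_of_ne R (Finset.mem_erase.1 hj).1]
  rw [esp_congr hc, esp_congr hc] at h3
  have h4 : Real.exp (η * ((addRequest R i) i : ℕ)) = Real.exp (η * R i) * Real.exp η := by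
    rw [← Real.exp_add, addRequest_self]
    push_cast
    ring_nf
  rw [h4] at h3
  linear_combination h3 - h2 - (Real.exp η - 1) * h1

/-- The total weight of the sets avoiding `i` is unchanged by a request of `i`; only the normalising
constant grows. -/
theorem sageMarginal_addRequest_self {C : ℕ} (hC1 : 1 ≤ C) (hC : C ≤ N) (η : ℝ)
    (R : Fin N → ℕ) (i : Fin N) :
    (1 - sageMarginal C η (addRequest R i) i) *
      (1 + sageMarginal C η R i * (Real.exp η - 1)) = 1 - sageMarginal C η R i := by
  refine mul_left_cancel₀ (hedgePartition_pos hC η R).ne' ?_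
  have h1 := sageMarginal_mul_hedgePartition hC η R i
  have h2 := hedgePartition_eq_add hC1 η R i
  have h3 := hedgePartition_eq_add hC1 η (addRequest R i) i
  have h5 := sageMarginal_mul_hedgePartition hC η (addRequest R i) i
  have h6 := hedgePartition_addRequest hC1 hC η R i
  have hc : ∀ j ∈ Finset.univ.erase i, (fun j => Real.exp (η * ((addRequest R i) j : ℕ))) j =
      (fun j => Real.exp (η * R j)) j := fun j hj => by
    simp only [addRequest_of_ne R (Finset.mem_erase.1 hj).1]
  rw [esp_congr hc C] at h3
  linear_combination (sageMarginal C η (addRequest R i) i - 1) * h6 + h3 - h5 - h2 + h1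

/-! ### Static hits and misses -/

/-- The number of hits, on requests with frequencies `R`, of the best fixed set of `C` files. -/
def staticHits (C : ℕ) (R : Fin N → ℕ) : ℕ :=
  (Finset.univ.powersetCard C).sup fun S => ∑ i ∈ S, R i

theorem sum_le_staticHits {C : ℕ} {S : Finset (Fin N)} (hS : S.card = C) (R : Fin N → ℕ) :
    ∑ i ∈ S, R i ≤ staticHits C R :=
  Finset.le_sup (f := fun S => ∑ i ∈ S, R i)
    (Finset.mem_powersetCard.2 ⟨Finset.subset_univ S, hS⟩)

theorem exists_staticHits {C : ℕ} (hC : C ≤ N) (R : Fin N → ℕ) :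
    ∃ S : Finset (Fin N), S.card = C ∧ staticHits C R = ∑ i ∈ S, R i := by
  obtain ⟨S, hS, h⟩ := Finset.exists_mem_eq_sup (Finset.univ.powersetCard C)
    (Finset.powersetCard_nonempty.2 (by simpa using hC)) fun S : Finset (Fin N) => ∑ i ∈ S, R i
  exact ⟨S, (Finset.mem_powersetCard.1 hS).2, h⟩

theorem staticMisses_add_staticHits (C : ℕ) (R : Fin N → ℕ) :
    staticMisses C R + staticHits C R = ∑ i, R i :=
  Nat.sub_add_cancel (Finset.sup_le fun S _ =>
    Finset.sum_le_sum_of_subset (Finset.subset_univ S))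

theorem sum_addRequest (R : Fin N → ℕ) (i : Fin N) (S : Finset (Fin N)) :
    ∑ j ∈ S, (addRequest R i) j = ∑ j ∈ S, R j + if i ∈ S then 1 else 0 := by
  simp [addRequest, Finset.sum_add_distrib]

theorem staticHits_le_addRequest {C : ℕ} (hC : C ≤ N) (R : Fin N → ℕ) (i : Fin N) :
    staticHits C R ≤ staticHits C (addRequest R i) := by
  obtain ⟨S, hS, h⟩ := exists_staticHits hC R
  have := sum_le_staticHits hS (addRequest R i)
  rw [sum_addRequest] at this
  omega

theorem staticHits_addRequest_le {C : ℕ} (hC : C ≤ N) (R : Fin N → ℕ) (i : Fin N) :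
    staticHits C (addRequest R i) ≤ staticHits C R + 1 := by
  obtain ⟨S, hS, h⟩ := exists_staticHits hC (addRequest R i)
  have := sum_le_staticHits hS R
  rw [sum_addRequest] at h
  split_ifs at h <;> omega

/-- If a request does not improve the best fixed set, the requested file has at most as many
requests as each of `C` other files. -/
theorem sageMarginal_le_of_staticHits_eq {C : ℕ} (hC1 : 1 ≤ C) (hC : C ≤ N) {η : ℝ}
    (hη : 0 ≤ η) {R : Fin N → ℕ} {i : Fin N}
    (h : staticHits C (addRequest R i) = staticHits C R) :
    (C + 1) * sageMarginal C η (addRequest R i) i ≤ C := by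
  obtain ⟨S, hS, hG⟩ := exists_staticHits hC R
  have hiS : i ∉ S := fun hi => by
    have := sum_le_staticHits hS (addRequest R i)
    rw [sum_addRequest, if_pos hi] at this
    omega
  -- Otherwise exchanging `j` for `i` would give a set with more than `staticHits C R` hits after
  -- the request.
  have hlt : ∀ j ∈ S, R i < R j := by
    intro j hj
    by_contra hle
    have hi' : i ∉ S.erase j := fun hh => hiS (Finset.mem_of_mem_erase hh)
    have hcard : (insert i (S.erase j)).card = C := by
      rw [Finset.card_insert_of_notMem hi', Finset.card_erase_of_mem hj, hS]
      omega
    have h1 := sum_le_staticHits hcard (addRequest R i)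
    rw [sum_addRequest, if_pos (Finset.mem_insert_self _ _), Finset.sum_insert hi'] at h1
    have h2 := Finset.add_sum_erase S R hj
    omega
  have hm : ∀ j ∈ S, sageMarginal C η (addRequest R i) i ≤
      sageMarginal C η (addRequest R i) j := by
    intro j hj
    refine sageMarginal_le_of_le hC hη ?_
    have hne : j ≠ i := fun hh => hiS (hh ▸ hj)
    have := hlt j hj
    rw [addRequest_self, addRequest_of_ne R hne]
    exact this
  have h1 := Finset.card_nsmul_le_sum S _ _ hm
  have h2 : ∑ j ∈ insert i S, sageMarginal C η (addRequest R i) j ≤ C := by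
    rw [← sum_sageMarginal hC1 hC η (addRequest R i)]
    exact Finset.sum_le_sum_of_subset_of_nonneg (Finset.subset_univ _)
      fun _ _ _ => sageMarginal_nonneg _ _ _
  rw [Finset.sum_insert hiS] at h2
  rw [hS, nsmul_eq_mul] at h1
  linarith

theorem staticMisses_eq_zero_of_card_le {C : ℕ} (hC : C ≤ N) {R : Fin N → ℕ}
    (h : (Finset.univ.filter fun i => R i ≠ 0).card ≤ C) : staticMisses C R = 0 := by
  obtain ⟨S, hsub, hS⟩ := Finset.exists_superset_card_eq h (by simpa using hC)
  have h1 := sum_le_staticHits hS R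
  have h2 : ∑ i ∈ S, R i = ∑ i, R i := by
    refine Finset.sum_subset (Finset.subset_univ S) fun i _ hi => ?_
    by_contra h0
    exact hi (hsub (Finset.mem_filter.2 ⟨Finset.mem_univ i, h0⟩))
  have := staticMisses_add_staticHits C R
  omega

/-! ### The excess of the log-partition function -/

/-- The logarithm of the partition function, relative to the weight of the best set. -/
noncomputable def logExcess (C : ℕ) (η : ℝ) (R : Fin N → ℕ) : ℝ :=
  Real.log (hedgePartition C η R) - η * staticHits C R

theorem logExcess_nonneg {C : ℕ} (hC : C ≤ N) (η : ℝ) (R : Fin N → ℕ) :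
    0 ≤ logExcess C η R := by
  obtain ⟨S, hS, h⟩ := exists_staticHits hC R
  rw [logExcess, sub_nonneg, Real.le_log_iff_exp_le (hedgePartition_pos hC η R), h,
    hedgePartition_eq_sum]
  exact Finset.single_le_sum (f := fun S => Real.exp (η * ((∑ i ∈ S, R i : ℕ) : ℝ)))
    (fun _ _ => (Real.exp_pos _).le)
    (Finset.mem_powersetCard.2 ⟨Finset.subset_univ S, hS⟩)

theorem choose_cast_pos {C : ℕ} (hC : C ≤ N) : (0 : ℝ) < N.choose C := by
  exact_mod_cast Nat.choose_pos hC

theorem logExcess_le {C : ℕ} (hC : C ≤ N) {η : ℝ} (hη : 0 ≤ η) (R : Fin N → ℕ) :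
    logExcess C η R ≤ Real.log (N.choose C) := by
  have h : hedgePartition C η R ≤ N.choose C * Real.exp (η * staticHits C R) := by
    rw [hedgePartition_eq_sum]
    refine (Finset.sum_le_card_nsmul _ _ (Real.exp (η * staticHits C R)) fun S hS => ?_).trans_eq ?_
    · have := sum_le_staticHits (Finset.mem_powersetCard.1 hS).2 R
      gcongr
    · rw [Finset.card_powersetCard, Finset.card_univ, Fintype.card_fin, nsmul_eq_mul]
  have h2 := Real.log_le_log (hedgePartition_pos hC η R) h
  rw [Real.log_mul (choose_cast_pos hC).ne' (Real.exp_pos _).ne', Real.log_exp] at h2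
  unfold logExcess
  linarith

/-- Power-mean inequality: `log (Q_η / N.choose C) / η` is nondecreasing in `η`, where `Q_η` is the
partition function. This is the price of lowering the rate. -/
theorem logExcess_le_of_le {C : ℕ} (hC : C ≤ N) {η η' : ℝ} (hη' : 0 < η') (h : η' ≤ η)
    (R : Fin N → ℕ) : logExcess C η' R ≤
      η' / η * logExcess C η R + (1 - η' / η) * Real.log (N.choose C) := by
  have hη : 0 < η := hη'.trans_le h
  have hM := choose_cast_pos hC
  have hcard : ((Finset.univ.powersetCard C : Finset (Finset (Fin N))).card : ℝ) = N.choose C := by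
    rw [Finset.card_powersetCard, Finset.card_univ, Fintype.card_fin]
  have hmean := Real.rpow_arith_mean_le_arith_mean_rpow (Finset.univ.powersetCard C)
    (fun _ => (1 : ℝ) / N.choose C)
    (fun S : Finset (Fin N) => Real.exp (η' * ((∑ i ∈ S, R i : ℕ) : ℝ)))
    (fun _ _ => by positivity)
    (by rw [Finset.sum_const, nsmul_eq_mul, hcard]; field_simp)
    (fun _ _ => (Real.exp_pos _).le) (p := η / η') ((one_le_div hη').2 h)
  simp_rw [← Real.exp_mul] at hmean
  rw [← Finset.mul_sum, ← Finset.mul_sum, ← hedgePartition_eq_sum] at hmean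
  have he : ∀ S : Finset (Fin N), η' * ((∑ i ∈ S, R i : ℕ) : ℝ) * (η / η') =
      η * ((∑ i ∈ S, R i : ℕ) : ℝ) := fun S => by field_simp
  simp_rw [he] at hmean
  rw [← hedgePartition_eq_sum] at hmean
  have hQ' := hedgePartition_pos hC η' R
  have hQ := hedgePartition_pos hC η R
  have hl := Real.log_le_log (by positivity) hmean
  rw [Real.log_rpow (by positivity), Real.log_mul (by positivity) hQ'.ne',
    Real.log_mul (by positivity) hQ.ne', one_div, Real.log_inv] at hl
  have hl2 := mul_le_mul_of_nonneg_left hl (div_nonneg hη'.le hη.le)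
  have e1 : η' / η * (η / η' * (-Real.log (N.choose C) + Real.log (hedgePartition C η' R))) =
      -Real.log (N.choose C) + Real.log (hedgePartition C η' R) := by field_simp
  have e2 : η' / η * (η * (staticHits C R : ℝ)) = η' * staticHits C R := by field_simp
  rw [e1] at hl2
  unfold logExcess
  rw [mul_sub, e2]
  linarith

theorem logExcess_addRequest {C : ℕ} (hC1 : 1 ≤ C) (hC : C ≤ N) {η : ℝ} (hη : 0 ≤ η)
    (R : Fin N → ℕ) (i : Fin N) : logExcess C η (addRequest R i) =
      logExcess C η R + Real.log (1 + sageMarginal C η R i * (Real.exp η - 1)) -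
        η * ((staticHits C (addRequest R i) : ℝ) - staticHits C R) := by
  have hp := sageMarginal_nonneg (C := C) η R i
  have he : 0 ≤ Real.exp η - 1 := by linarith [Real.add_one_le_exp η]
  rw [logExcess, hedgePartition_addRequest hC1 hC, Real.log_mul (hedgePartition_pos hC η R).ne'
    (by positivity), logExcess]
  ring

end Marginals

/-! ### Scalar inequalities for the loss of Hedge -/

theorem one_sub_exp_neg_pos {η : ℝ} (hη : 0 < η) : 0 < 1 - Real.exp (-η) := by
  have := Real.exp_lt_exp.2 (neg_lt_zero.2 hη)
  rw [Real.exp_zero] at this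
  linarith

/-- The factor by which the loss of Hedge exceeds the decrease of the log-partition function. -/
noncomputable def lossFactor (η : ℝ) : ℝ := (1 - Real.exp (-η))⁻¹

theorem lossFactor_pos {η : ℝ} (hη : 0 < η) : 0 < lossFactor η :=
  inv_pos.2 (one_sub_exp_neg_pos hη)

/-- By convexity of `exp`, `(1 - exp (-η)) / η` decreases in `η`. Hence lowering the rate does not
inflate the excess already in the potential. -/
theorem lossFactor_mul_div_le {η η' : ℝ} (hη' : 0 < η') (h : η' ≤ η) :
    lossFactor η' * (η' / η) ≤ lossFactor η := by
  have hη : 0 < η := hη'.trans_le h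
  have h1 := one_sub_exp_neg_pos hη
  have h2 := one_sub_exp_neg_pos hη'
  have hle : η' / η ≤ 1 := (div_le_one hη).2 h
  have hc := convexOn_exp.2 (Set.mem_univ 0) (Set.mem_univ (-η)) (sub_nonneg.2 hle)
    (div_pos hη' hη).le (by ring)
  simp only [smul_eq_mul, mul_zero, zero_add, Real.exp_zero, mul_one] at hc
  rw [show η' / η * -η = -η' by field_simp] at hc
  rw [lossFactor, lossFactor, ← one_div, ← one_div, div_mul_eq_mul_div, one_mul,
    div_le_div_iff₀ h2 h1]
  linarith

/-- Excess over its probability `p` of the (scaled) mix gain of a request. -/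
noncomputable def mixGap (η p : ℝ) : ℝ :=
  lossFactor η * Real.log (1 + p * (Real.exp η - 1)) - p

theorem mixGap_le_log {η p c : ℝ} (hη : 0 < η) (hp : 0 ≤ p)
    (h : 1 + p * (Real.exp η - 1) ≤ c) : mixGap η p ≤ lossFactor η * Real.log c := by
  have he : 0 ≤ Real.exp η - 1 := by linarith [Real.add_one_le_exp η]
  have := mul_le_mul_of_nonneg_left (Real.log_le_log (by positivity) h) (lossFactor_pos hη).le
  unfold mixGap
  linarith

/-- The gap is concave in `p`, and `lossFactor` makes its tangent at `p = 1` horizontal, so the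
bound is its value there. -/
theorem mixGap_le {η p : ℝ} (hη : 0 < η) (hp : 0 ≤ p) :
    mixGap η p ≤ lossFactor η * η - 1 := by
  have he : 0 ≤ Real.exp η - 1 := by linarith [Real.add_one_le_exp η]
  have hP : 0 < 1 + p * (Real.exp η - 1) := by positivity
  have h1 := one_sub_exp_neg_pos hη
  have hl := Real.log_le_sub_one_of_pos (x := (1 + p * (Real.exp η - 1)) * Real.exp (-η))
    (by positivity)
  rw [Real.log_mul hP.ne' (Real.exp_pos _).ne', Real.log_exp] at hl
  have hee : Real.exp η * Real.exp (-η) = 1 := by rw [← Real.exp_add]; simp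
  have hl2 : Real.log (1 + p * (Real.exp η - 1)) ≤ η - (1 - p) * (1 - Real.exp (-η)) := by
    linear_combination hl + p * hee
  have h3 := mul_le_mul_of_nonneg_left hl2 (lossFactor_pos hη).le
  have h4 : lossFactor η * ((1 - p) * (1 - Real.exp (-η))) = 1 - p := by
    rw [lossFactor]; field_simp
  unfold mixGap
  rw [mul_sub (lossFactor η), h4] at h3
  linarith

theorem log_one_add_le_cubic {t : ℝ} (ht : 0 ≤ t) :
    Real.log (1 + t) ≤ t - t ^ 2 / 2 + t ^ 3 / 3 := by
  have hd : ∀ s ∈ Set.Ici (0 : ℝ), HasDerivAt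
      (fun s : ℝ => s - s ^ 2 / 2 + s ^ 3 / 3 - Real.log (1 + s))
      (1 - s + s ^ 2 - 1 / (1 + s)) s := by
    intro s hs
    have hs : (0 : ℝ) ≤ s := hs
    have h1 : HasDerivAt (fun s : ℝ => Real.log (1 + s)) (1 / (1 + s)) s :=
      ((hasDerivAt_id s).const_add 1).log (by simp only [id]; positivity)
    refine HasDerivAt.congr_deriv ((((hasDerivAt_id s).sub
      (((hasDerivAt_id s).pow 2).div_const 2)).add
      (((hasDerivAt_id s).pow 3).div_const 3)).sub h1) ?_
    simp only [id, Nat.cast_ofNat, mul_one, Nat.add_one_sub_one, pow_one]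
    ring
  have hm : MonotoneOn (fun s : ℝ => s - s ^ 2 / 2 + s ^ 3 / 3 - Real.log (1 + s))
      (Set.Ici 0) := by
    refine monotoneOn_of_deriv_nonneg (convex_Ici 0)
      (fun s hs => (hd s hs).continuousAt.continuousWithinAt)
      (fun s hs => (hd s (interior_subset hs)).differentiableAt.differentiableWithinAt)
      (fun s hs => ?_)
    have hs' : (0 : ℝ) ≤ s := interior_subset hs
    rw [(hd s hs').deriv]
    have : 1 - s + s ^ 2 - 1 / (1 + s) = s ^ 3 / (1 + s) := by field_simp; ring
    rw [this]
    positivity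
  have := hm (Set.mem_Ici.2 le_rfl) (Set.mem_Ici.2 ht) ht
  simp at this
  linarith

/-- The sharper bound on `mixGap` that holds when a single file fits in the cache. -/
theorem mixGap_le_of_le_two {η p t : ℝ} (hη : 0 < η)
    (h : 1 + p * (Real.exp η - 1) ≤ 2 * (1 - p)) (hp : 0 ≤ p)
    (ht : t = (Real.exp η - 1) / (Real.exp η + 1)) :
    mixGap η p ≤ 3 / 4 * t - t ^ 2 / 12 + t ^ 3 / 6 := by
  have he : 0 < Real.exp η - 1 := by linarith [Real.add_one_lt_exp hη.ne']
  set e := Real.exp η with hee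
  have he1 : 0 < e + 1 := by linarith
  have he0 : 0 < e := Real.exp_pos η
  have ht0 : 0 < t := by rw [ht]; positivity
  have ht1 : 1 - t = 2 / (e + 1) := by rw [ht]; field_simp; ring
  have hP0 : 1 + t = 2 * e / (e + 1) := by rw [ht]; field_simp; ring
  have hk : lossFactor η = e / (e - 1) := by
    rw [lossFactor, Real.exp_neg, ← hee, show 1 - e⁻¹ = (e - 1) / e by field_simp, inv_div]
  have hP : 0 < 1 + p * (e - 1) := by positivity
  -- Tangent of the logarithm at `1 + t`, the value of `1 + p * (e - 1)` at the largest admissible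
  -- `p = 1 / (e + 1) = (1 - t) / 2`. The resulting bound is increasing in `p`, so this endpoint is
  -- the worst case.
  have hl := Real.log_le_sub_one_of_pos (x := (1 + p * (e - 1)) / (1 + t)) (by positivity)
  rw [Real.log_div hP.ne' (by positivity)] at hl
  have hl2 := log_one_add_le_cubic ht0.le
  have hl3 : Real.log (1 + p * (e - 1)) ≤
      t - t ^ 2 / 2 + t ^ 3 / 3 + ((1 + p * (e - 1)) / (1 + t) - 1) := by linarith
  have hl4 := mul_le_mul_of_nonneg_left hl3 (lossFactor_pos hη).le
  have hk2 : lossFactor η = (1 + t) / (2 * t) := by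
    rw [hk, hP0, ht]; field_simp
  have hA : lossFactor η * (t - t ^ 2 / 2 + t ^ 3 / 3) =
      (1 + t) * (1 / 2 - t / 4 + t ^ 2 / 6) := by
    rw [hk2]; field_simp; ring
  have hB : lossFactor η * ((1 + p * (e - 1)) / (1 + t) - 1) =
      (p - (1 - t) / 2) * ((e + 1) / 2) := by
    rw [hk, hP0, ht1]; field_simp; ring
  have hp0 : p ≤ (1 - t) / 2 := by
    rw [ht1, div_div, mul_comm (e + 1) 2, ← div_div, div_self two_ne_zero, le_div_iff₀ he1]
    linarith
  have hC : (p - (1 - t) / 2) * ((e + 1) / 2) ≤ (p - (1 - t) / 2) * 1 :=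
    mul_le_mul_of_nonpos_left (by linarith) (by linarith)
  rw [mul_add, hA, hB] at hl4
  unfold mixGap
  nlinarith

theorem exp_neg_le_quartic {η : ℝ} (h0 : 0 ≤ η) (h1 : η ≤ 1) :
    Real.exp (-η) ≤ 1 - η + η ^ 2 / 2 - η ^ 3 / 6 + 5 / 96 * η ^ 4 := by
  have h := Real.exp_bound (x := -η) (n := 4) (by rw [abs_neg, abs_of_nonneg h0]; exact h1)
    (by norm_num)
  have h2 := (abs_le.1 h).2
  rw [abs_neg, abs_of_nonneg h0] at h2
  simp [Finset.sum_range_succ, Nat.factorial] at h2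
  nlinarith

theorem exp_le_quartic {η : ℝ} (h0 : 0 ≤ η) (h1 : η ≤ 1) :
    Real.exp η ≤ 1 + η + η ^ 2 / 2 + η ^ 3 / 6 + 5 / 96 * η ^ 4 := by
  have h := Real.exp_bound' h0 h1 (n := 4) (by norm_num)
  simp [Finset.sum_range_succ, Nat.factorial] at h
  nlinarith

/-- The number `0.4473` lies just above `1 / √5`, which bounds the rate `√(D / (l + 1))` once `l ≥ 5
* D`. -/
theorem lossFactor_mul_le {η : ℝ} (h0 : 0 < η) (h1 : η ≤ 0.4473) :
    lossFactor η * η ≤ 5 / 4 := by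
  have h := exp_neg_le_quartic h0.le (by linarith)
  have hpos := one_sub_exp_neg_pos h0
  rw [lossFactor, inv_mul_eq_div, div_le_iff₀ hpos]
  have h2 : η ^ 2 ≤ 0.4473 * η := by nlinarith
  have h3 : 0 ≤ 1 / 5 - η / 2 + η ^ 2 / 6 - 5 / 96 * η ^ 3 := by
    nlinarith [mul_nonneg h0.le (sub_nonneg.2 h1), sq_nonneg (0.4473 - η),
      mul_nonneg h0.le (sq_nonneg (0.4473 - η))]
  nlinarith [mul_nonneg h0.le h3]

theorem lossFactor_mul_sub_one_le {η : ℝ} (h0 : 0 < η) (h1 : η ≤ 0.4473) :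
    lossFactor η * η - 1 ≤ 0.59 * η := by
  have h := exp_neg_le_quartic h0.le (by linarith)
  have hpos := one_sub_exp_neg_pos h0
  suffices lossFactor η * η ≤ 1 + 0.59 * η by linarith
  rw [lossFactor, inv_mul_eq_div, div_le_iff₀ hpos]
  have h4 : (1 + 0.59 * η) * (η - η ^ 2 / 2 + η ^ 3 / 6 - 5 / 96 * η ^ 4) ≤
      (1 + 0.59 * η) * (1 - Real.exp (-η)) :=
    mul_le_mul_of_nonneg_left (by linarith) (by positivity)
  refine le_trans ?_ h4
  have h5 : 0 ≤ 0.09 - (0.295 - 1 / 6) * η + (0.59 / 6 - 5 / 96) * η ^ 2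
      - 0.59 * 5 / 96 * η ^ 3 := by
    nlinarith [mul_nonneg h0.le (sub_nonneg.2 h1),
      mul_nonneg (sq_nonneg η) (sub_nonneg.2 h1)]
  nlinarith [mul_nonneg (sq_nonneg η) h5]

theorem exp_sub_div_exp_add_le {η : ℝ} (h0 : 0 < η) (h1 : η ≤ 1) :
    (Real.exp η - 1) / (Real.exp η + 1) ≤ η / 2 := by
  have h := exp_le_quartic h0.le h1
  rw [div_le_div_iff₀ (by positivity) two_pos]
  have h2 : Real.exp η * (2 - η) ≤
      (1 + η + η ^ 2 / 2 + η ^ 3 / 6 + 5 / 96 * η ^ 4) * (2 - η) :=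
    mul_le_mul_of_nonneg_right h (by linarith)
  nlinarith [pow_pos h0 3, pow_pos h0 4, pow_pos h0 5]

theorem mixGap_le_linear {η p : ℝ} (hη : 0 < η) (h1 : η ≤ 0.4473)
    (h : 1 + p * (Real.exp η - 1) ≤ 2 * (1 - p)) (hp : 0 ≤ p) :
    mixGap η p ≤ 3 / 8 * η := by
  have hb := mixGap_le_of_le_two hη h hp rfl
  set t := (Real.exp η - 1) / (Real.exp η + 1) with ht
  have ht0 : 0 ≤ t := by
    have : 0 ≤ Real.exp η - 1 := by linarith [Real.add_one_le_exp η]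
    positivity
  have ht1 : t ≤ η / 2 := exp_sub_div_exp_add_le hη (by linarith)
  have : t ^ 2 * (1 / 12 - t / 6) ≥ 0 := mul_nonneg (sq_nonneg _) (by linarith)
  nlinarith

theorem exp_neg_one_lt : Real.exp (-1) < 0.3679 := by
  have h := Real.exp_one_gt_d9
  have hm : Real.exp (-1) * Real.exp 1 = 1 := by rw [← Real.exp_add]; simp
  nlinarith [Real.exp_pos (-1)]

theorem lossFactor_one_le : lossFactor 1 ≤ 1.583 := by
  have h := exp_neg_one_lt
  rw [lossFactor, inv_le_comm₀ (by linarith) (by norm_num)]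
  norm_num at h ⊢
  linarith

theorem mixGap_one_le {p : ℝ} (hp : 0 ≤ p) : mixGap 1 p ≤ 0.6 := by
  have := mixGap_le one_pos hp
  have := lossFactor_one_le
  norm_num at *
  linarith

theorem mixGap_one_le_of_le_two {p : ℝ} (hp : 0 ≤ p)
    (h : 1 + p * (Real.exp 1 - 1) ≤ 2 * (1 - p)) : mixGap 1 p ≤ 0.346 := by
  have hb := mixGap_le_of_le_two one_pos h hp rfl
  have h1 := Real.exp_one_gt_d9
  have h2 := Real.exp_one_lt_d9
  set t := (Real.exp 1 - 1) / (Real.exp 1 + 1) with ht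
  have ht0 : 0.462 ≤ t := by
    rw [ht, le_div_iff₀ (by positivity)]; norm_num at *; linarith
  have ht1 : t ≤ 0.4622 := by
    rw [ht, div_le_iff₀ (by positivity)]; norm_num at *; linarith
  norm_num at ht0 ht1 ⊢
  nlinarith [mul_nonneg (sub_nonneg.2 ht0) (sub_nonneg.2 ht1)]

/-! ### The tuning rule of Sage and the regret it guarantees -/

/-- The tuning rule of Sage: aggressive for the first `D` misses, constant up to `5 * D` misses and
then of the order `√(D / l)`. -/
noncomputable def sageRate (D : ℝ) (l : ℕ) : ℝ :=
  if (l : ℝ) < D then Real.log (1000 * D) else if (l : ℝ) < 5 * D then 1 else √(D / (l + 1))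

/-- Regret per miss at learning rate `1`. -/
noncomputable def unitRateSlope (C : ℕ) : ℝ := if C = 1 then 0.346 else 0.6

/-- Bound on the regret of Sage with tuning rule `sageRate` once the best fixed set has `l`
misses. -/
noncomputable def sageRegretBound (C : ℕ) (D lam : ℝ) (l : ℕ) : ℝ :=
  if (l : ℝ) < D then lossFactor (Real.log (1000 * D)) * lam + 0.7 * C * l
  else if (l : ℝ) < 5 * D then D + 0.7 * (C * D) + 1.583 * lam + unitRateSlope C * (l - D)
  else (C + 1) * D + √(2 * (C + 1)) * √(D * l)

theorem log_thousand_mul_pos {D : ℝ} (hD : 1 ≤ D) : 0 < Real.log (1000 * D) :=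
  Real.log_pos (by linarith)

theorem sageRate_pos {D : ℝ} (hD : 1 ≤ D) (l : ℕ) : 0 < sageRate D l := by
  unfold sageRate
  split_ifs
  · exact log_thousand_mul_pos hD
  · exact one_pos
  · positivity

theorem lossFactor_log_eq {D : ℝ} (hD : 1 ≤ D) :
    lossFactor (Real.log (1000 * D)) = 1000 * D / (1000 * D - 1) := by
  have h : (1000 * D - 1) ≠ 0 := by linarith
  rw [lossFactor, Real.exp_neg, Real.exp_log (by linarith),
    show 1 - (1000 * D)⁻¹ = (1000 * D - 1) / (1000 * D) by field_simp, inv_div]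

/-- The initial rate is large enough for the slack `1` in `lam ≤ D - 1` to absorb the excess of the
loss factor over `1`. -/
theorem lossFactor_log_mul_le {D lam : ℝ} (hD : 1 ≤ D) (hlam : lam ≤ D - 1) :
    lossFactor (Real.log (1000 * D)) * lam ≤ D := by
  have h : 0 < 1000 * D - 1 := by linarith
  rw [lossFactor_log_eq hD, div_mul_eq_mul_div, div_le_iff₀ h]
  nlinarith

theorem lossFactor_log_mul_log_le {D : ℝ} (hD : 1 ≤ D) (C : ℕ) :
    lossFactor (Real.log (1000 * D)) * Real.log (C + 1) ≤ 0.7 * C := by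
  have h : 0 < 1000 * D - 1 := by linarith
  have h1 : lossFactor (Real.log (1000 * D)) ≤ 1.0011 := by
    rw [lossFactor_log_eq hD, div_le_iff₀ h]
    norm_num
    linarith
  have h2 : Real.log (C + 1) ≤ C * Real.log 2 := by
    rw [← Real.log_pow]
    refine Real.log_le_log (by positivity) ?_
    exact_mod_cast Nat.succ_le_of_lt (Nat.lt_two_pow_self (n := C))
  have h3 := Real.log_two_lt_d9
  have hC : (0 : ℝ) ≤ C := by positivity
  calc lossFactor (Real.log (1000 * D)) * Real.log (C + 1)
      ≤ 1.0011 * (C * 0.6931471808) := by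
        refine mul_le_mul h1 (h2.trans (by gcongr)) (Real.log_nonneg (by linarith)) (by norm_num)
    _ ≤ 0.7 * C := by
        norm_num
        linarith

theorem unitRateSlope_cases {C : ℕ} (hC : 1 ≤ C) :
    (C = 1 ∧ √(2 * ((C : ℝ) + 1)) = 2 ∧ unitRateSlope C = 0.346) ∨
      (2 ≤ C ∧ 2.449 ≤ √(2 * ((C : ℝ) + 1)) ∧ unitRateSlope C = 0.6) := by
  rcases hC.eq_or_lt with rfl | h
  · refine Or.inl ⟨rfl, ?_, by simp [unitRateSlope]⟩
    rw [show 2 * (((1 : ℕ) : ℝ) + 1) = 2 ^ 2 by norm_num, Real.sqrt_sq two_pos.le]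
  · refine Or.inr ⟨h, Real.le_sqrt_of_sq_le ?_, by simp [unitRateSlope, h.ne']⟩
    have : (2 : ℝ) ≤ C := by exact_mod_cast h
    norm_num
    linarith

/-- Nodes without static misses may have seen a single file, so here the bound must be `D`, not `(C
+ 1) * D`. -/
theorem sageRegretBound_zero_le {C : ℕ} {D lam : ℝ} (hD : 1 ≤ D) (hlam : lam ≤ D - 1) :
    sageRegretBound C D lam 0 ≤ D := by
  have : ((0 : ℕ) : ℝ) < D := by norm_num; linarith
  rw [sageRegretBound, if_pos this]
  simpa using lossFactor_log_mul_le hD hlam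

theorem sageRegretBound_le {C : ℕ} (hC : 1 ≤ C) {D lam : ℝ} (hD : 1 ≤ D) (hlam : lam ≤ D - 1)
    (l : ℕ) :
    sageRegretBound C D lam l ≤ (C + 1) * D + √(2 * (C + 1)) * √(D * l) := by
  have hC1 : (1 : ℝ) ≤ C := by exact_mod_cast hC
  have hs : 0 ≤ √(2 * ((C : ℝ) + 1)) * √(D * l) := by positivity
  unfold sageRegretBound
  split_ifs with h1 h2
  · have h3 := lossFactor_log_mul_le hD hlam
    have h4 : (C : ℝ) * l ≤ C * D := by gcongr
    have h5 : 0 ≤ (C : ℝ) * D := by positivity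
    linarith
  · rw [not_lt] at h1
    set u := √(D * l) with hu
    have hu2 : u ^ 2 = D * l := Real.sq_sqrt (by positivity)
    have hu0 : 0 ≤ u := Real.sqrt_nonneg _
    have huD : D ≤ u := Real.le_sqrt_of_sq_le (by nlinarith)
    have huD' : u ≤ 2.237 * D := by
      refine Real.sqrt_le_iff.2 ⟨by positivity, ?_⟩
      norm_num
      nlinarith
    -- Here `l - D = (u - D) * (u + D) / D`, and `u ≤ √5 * D` because `l < 5 * D`.
    have hl : (l : ℝ) - D ≤ 3.237 * (u - D) := by
      refine le_of_mul_le_mul_left ?_ (zero_lt_one.trans_le hD)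
      have := mul_le_mul_of_nonneg_left (show u + D ≤ 3.237 * D by norm_num at *; linarith)
        (sub_nonneg.2 huD)
      norm_num at *
      linarith
    rcases unitRateSlope_cases hC with ⟨rfl, hc, hj⟩ | ⟨h2C, hc, hj⟩
    · rw [hj, hc]
      norm_num at *
      linarith
    · have h6 : (2 : ℝ) * D ≤ C * D := by
        gcongr
        exact_mod_cast h2C
      have h7 := mul_le_mul_of_nonneg_right hc hu0
      rw [hj]
      norm_num at *
      linarith
  · exact le_rfl

/-- One step of `√(D * l)` is at least `η / 2`. Of its coefficient `√(2 * (C + 1))`, the amount `5 /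
4` is reserved for lowering the rate, and the rest pays the mix gap. For `C = 1` this is exactly `2
* (3 / 8) = 2 - 5 / 4`, which requires the sharper gap bound. -/
theorem mixGap_small_rate_le {C : ℕ} (hC : 1 ≤ C) {η p : ℝ} (h0 : 0 < η) (h1 : η ≤ 0.4473)
    (hp : 0 ≤ p) (h : 1 + p * (Real.exp η - 1) ≤ (C + 1) * (1 - p)) :
    2 * mixGap η p ≤ (√(2 * ((C : ℝ) + 1)) - 5 / 4) * η := by
  rcases unitRateSlope_cases hC with ⟨rfl, hc, -⟩ | ⟨-, hc, -⟩
  · have := mixGap_le_linear h0 h1 (by norm_num at h; exact h) hp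
    rw [hc]
    linarith
  · have h2 := mixGap_le h0 hp
    have h3 := lossFactor_mul_sub_one_le h0 h1
    have h4 : (2 * 0.59) * η ≤ (√(2 * ((C : ℝ) + 1)) - 5 / 4) * η :=
      mul_le_mul_of_nonneg_right (by norm_num at *; linarith) h0.le
    linarith

theorem mixGap_unit_rate_le {C : ℕ} (hC : 1 ≤ C) {p : ℝ} (hp : 0 ≤ p)
    (h : 1 + p * (Real.exp 1 - 1) ≤ (C + 1) * (1 - p)) : mixGap 1 p ≤ unitRateSlope C := by
  rcases unitRateSlope_cases hC with ⟨rfl, -, hj⟩ | ⟨-, -, hj⟩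
  · rw [hj]
    exact mixGap_one_le_of_le_two hp (by norm_num at h; exact h)
  · rw [hj]
    exact mixGap_one_le hp

theorem sqrt_div_eq {D y : ℝ} (hD : 0 < D) (hy : 0 < y) : √(D / y) = D / √(D * y) := by
  rw [Real.sqrt_div hD.le, Real.sqrt_mul hD.le, div_eq_div_iff (by positivity) (by positivity),
    ← mul_assoc, Real.mul_self_sqrt hD.le]

theorem sqrt_div_le {D y : ℝ} (hD : 0 < D) (hy : 5 * D ≤ y) : √(D / y) ≤ 0.4473 := by
  have hy0 : 0 < y := by linarith
  refine Real.sqrt_le_iff.2 ⟨by norm_num, ?_⟩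
  rw [div_le_iff₀ hy0]
  norm_num
  linarith

theorem sqrt_rate_step {C : ℕ} (hC : 1 ≤ C) {D lam l p : ℝ} (hD : 1 ≤ D) (hlam0 : 0 ≤ lam)
    (hlam : lam ≤ D) (hB : 5 * D ≤ l) (hp : 0 ≤ p)
    (h : 1 + p * (Real.exp (√(D / (l + 1))) - 1) ≤ (C + 1) * (1 - p)) :
    mixGap (√(D / (l + 1))) p +
        lossFactor (√(D / (l + 1 + 1))) * (1 - √(D / (l + 1 + 1)) / √(D / (l + 1))) * lam ≤
      √(2 * (C + 1)) * (√(D * (l + 1)) - √(D * l)) := by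
  have hD0 : 0 < D := by linarith
  have hl0 : 0 ≤ l := by linarith
  have hηη : √(D / (l + 1 + 1)) ≤ √(D / (l + 1)) := by
    gcongr
    linarith
  have hη := sqrt_div_le (y := l + 1) hD0 (by linarith)
  set η := √(D / (l + 1)) with hη_def
  set η' := √(D / (l + 1 + 1)) with hη_def'
  have hη0 : 0 < η := by positivity
  have hη0' : 0 < η' := by positivity
  have hg := mixGap_small_rate_le hC hη0 hη hp h
  have hK := lossFactor_mul_le hη0' (hηη.trans hη)
  set u := √(D * l) with hu
  set v := √(D * (l + 1)) with hv
  set w := √(D * (l + 1 + 1)) with hw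
  have hηv : η = D / v := sqrt_div_eq hD0 (by positivity)
  have hηw : η' = D / w := sqrt_div_eq hD0 (by positivity)
  have hu0 : 0 ≤ u := by positivity
  have hv0 : 0 < v := by positivity
  have hw0 : 0 < w := by positivity
  have hu2 : u ^ 2 = D * l := Real.sq_sqrt (by positivity)
  have hv2 : v ^ 2 = D * (l + 1) := Real.sq_sqrt (by positivity)
  have hw2 : w ^ 2 = D * (l + 1 + 1) := Real.sq_sqrt (by positivity)
  have huv : u ≤ v := Real.sqrt_le_sqrt (by nlinarith)
  have hvw : v ≤ w := Real.sqrt_le_sqrt (by nlinarith)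
  -- Concavity of the square root: the rate change costs a multiple of the next increment `w - v`,
  -- while the bound grows by a multiple of `v - u`.
  have hcv : w - v ≤ v - u := by
    have h1 : (w - v) * (w + v) = D := by linear_combination hw2 - hv2
    have h2 : (v - u) * (v + u) = D := by linear_combination hv2 - hu2
    by_contra hlt
    rw [not_le] at hlt
    nlinarith [mul_pos (sub_pos.2 hlt) hv0]
  have hη2 : η ≤ 2 * (v - u) := by
    rw [hηv, div_le_iff₀ hv0]
    nlinarith
  have e1 : lossFactor η' * (1 - η' / η) * lam =
      lossFactor η' * η' * ((w - v) * (lam / D)) := by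
    rw [hηw, hηv]; field_simp
  have hl1 : lam / D ≤ 1 := (div_le_one hD0).2 (by linarith)
  have h1 : (w - v) * (lam / D) ≤ v - u :=
    (mul_le_of_le_one_right (sub_nonneg.2 hvw) hl1).trans hcv
  have h2 : lossFactor η' * η' * ((w - v) * (lam / D)) ≤ 5 / 4 * (v - u) :=
    mul_le_mul hK h1 (mul_nonneg (sub_nonneg.2 hvw) (by positivity)) (by norm_num)
  have hc : 0 ≤ √(2 * ((C : ℝ) + 1)) - 5 / 4 := by
    rcases unitRateSlope_cases hC with ⟨-, hc, -⟩ | ⟨-, hc, -⟩ <;> norm_num at hc ⊢ <;>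
      linarith
  have h3 := mul_le_mul_of_nonneg_left hη2 hc
  rw [e1]
  linarith

/-- When the number of misses of the best fixed set grows, either the bound on the regret grows by
enough to restart Sage with the new learning rate, or the learning rate decreases and the bound on
the regret grows by enough to pay for this decrease and for the miss. -/
theorem sageRegretBound_step {C : ℕ} (hC : 1 ≤ C) {D lam : ℝ} (hD : 1 ≤ D) (hlam0 : 0 ≤ lam)
    (hlam : lam ≤ D - 1) (l : ℕ) :
    lossFactor (sageRate D (l + 1)) * lam ≤
        sageRegretBound C D lam (l + 1) - sageRegretBound C D lam l ∨
      sageRate D (l + 1) ≤ sageRate D l ∧ ∀ p : ℝ, 0 ≤ p →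
        1 + p * (Real.exp (sageRate D l) - 1) ≤ (C + 1) * (1 - p) →
        mixGap (sageRate D l) p +
          lossFactor (sageRate D (l + 1)) * (1 - sageRate D (l + 1) / sageRate D l) * lam ≤
          sageRegretBound C D lam (l + 1) - sageRegretBound C D lam l := by
  have hC1 : (1 : ℝ) ≤ C := by exact_mod_cast hC
  have hD0 : 0 < D := by linarith
  have hl0 : (0 : ℝ) ≤ l := by positivity
  have hlogpos := log_thousand_mul_pos hD
  unfold sageRate sageRegretBound
  push_cast
  by_cases hA : (l : ℝ) < D
  · rw [if_pos hA, if_pos hA]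
    by_cases hA' : (l : ℝ) + 1 < D
    · right
      rw [if_pos hA', if_pos hA']
      refine ⟨le_rfl, fun p hp h => ?_⟩
      have h1 : 1 + p * (Real.exp (Real.log (1000 * D)) - 1) ≤ (C : ℝ) + 1 := by nlinarith
      have h2 := mixGap_le_log hlogpos hp h1
      have h3 := lossFactor_log_mul_log_le hD C
      rw [div_self hlogpos.ne']
      linarith
    -- On leaving the aggressive phase the old excess is discarded: the term `1.583 * lam` pays for
    -- a fresh start at rate `1`.
    · left
      have h5 : (l : ℝ) + 1 < 5 * D := by linarith
      rw [if_neg hA', if_pos h5, if_neg hA', if_pos h5]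
      have h1 := lossFactor_log_mul_le hD hlam
      have h2 := mul_le_mul_of_nonneg_right lossFactor_one_le hlam0
      have h3 : (C : ℝ) * l ≤ C * D := by gcongr
      have h4 : 0 ≤ unitRateSlope C * ((l : ℝ) + 1 - D) := by
        refine mul_nonneg ?_ (by linarith)
        rcases unitRateSlope_cases hC with ⟨-, -, hj⟩ | ⟨-, -, hj⟩ <;> rw [hj] <;> norm_num
      linarith
  · have hA' : ¬ (l : ℝ) + 1 < D := by linarith
    rw [if_neg hA, if_neg hA, if_neg hA', if_neg hA']
    right
    by_cases hB : (l : ℝ) < 5 * D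
    · rw [if_pos hB, if_pos hB]
      by_cases hB' : (l : ℝ) + 1 < 5 * D
      · rw [if_pos hB', if_pos hB']
        refine ⟨le_rfl, fun p hp h => ?_⟩
        have := mixGap_unit_rate_le hC hp h
        rw [div_one]
        linarith
      · rw [if_neg hB', if_neg hB']
        rw [not_lt] at hB'
        have hη := sqrt_div_le (y := (l : ℝ) + 1 + 1) hD0 (by linarith)
        refine ⟨hη.trans (by norm_num), fun p hp h => ?_⟩
        have hg := mixGap_unit_rate_le hC hp h
        set η := √(D / ((l : ℝ) + 1 + 1)) with hη_def
        have hη0 : 0 < η := by positivity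
        have hK := lossFactor_mul_le hη0 hη
        set v := √(D * ((l : ℝ) + 1)) with hv
        set w := √(D * ((l : ℝ) + 1 + 1)) with hw
        have hηw : η = D / w := sqrt_div_eq hD0 (by positivity)
        have hv0 : 0 < v := by positivity
        have hw0 : 0 < w := by positivity
        have hv2 : v ^ 2 = D * (l + 1) := Real.sq_sqrt (by positivity)
        have hw2 : w ^ 2 = D * (l + 1 + 1) := Real.sq_sqrt (by positivity)
        have hvD : 2.236 * D ≤ v := Real.le_sqrt_of_sq_le (by norm_num; nlinarith)
        have hwv : w ≤ v + 0.25 := by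
          refine Real.sqrt_le_iff.2 ⟨by positivity, ?_⟩
          norm_num at *
          nlinarith
        have hwD : D ≤ w := Real.le_sqrt_of_sq_le (by nlinarith)
        -- The drop from rate `1` to `D / w` costs at most `5 / 4 * (w - D)`; this is paid by the
        -- jump of the bound when its formula changes at `5 * D`.
        have e1 : lossFactor η * (1 - η / 1) * lam = lossFactor η * η * ((w / D - 1) * lam) := by
          rw [hηw]; field_simp
        have hq : 0 ≤ w / D - 1 := sub_nonneg.2 ((one_le_div hD0).2 hwD)
        have e2 : (w / D - 1) * (D - 1) = w - D - (w / D - 1) := by field_simp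
        have h1 : (w / D - 1) * lam ≤ w - D := by
          have := mul_le_mul_of_nonneg_left hlam hq
          linarith
        have h2 : lossFactor η * η * ((w / D - 1) * lam) ≤ 5 / 4 * (w - D) :=
          mul_le_mul hK h1 (mul_nonneg hq hlam0) (by norm_num)
        rw [e1]
        rcases unitRateSlope_cases hC with ⟨rfl, hc, hj⟩ | ⟨h2C, hc, hj⟩
        · rw [hj] at hg ⊢
          rw [hc]
          norm_num at *
          linarith
        · have h6 : (2 : ℝ) * D ≤ C * D := by
            gcongr
            exact_mod_cast h2C
          have h7 := mul_le_mul_of_nonneg_right hc hv0.le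
          rw [hj] at hg ⊢
          norm_num at *
          linarith
    · have hB' : ¬ (l : ℝ) + 1 < 5 * D := by linarith
      rw [if_neg hB, if_neg hB, if_neg hB', if_neg hB']
      rw [not_lt] at hB
      refine ⟨Real.sqrt_le_sqrt (by gcongr; linarith), fun p hp h => ?_⟩
      have := sqrt_rate_step hC hD hlam0 (by linarith) hB hp h
      linarith

/-! ### The number of sets of files -/

theorem log_factorial_ge {n : ℕ} (hn : 1 ≤ n) :
    1 + n * Real.log n - n ≤ Real.log n.factorial := by
  induction n, hn using Nat.le_induction with
  | base => simp
  | succ n hn ih =>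
    have hn0 : (0 : ℝ) < n := by exact_mod_cast hn
    have h1 : Real.log (n + 1) ≤ Real.log n + 1 / n := by
      have h := Real.log_le_sub_one_of_pos (x := ((n : ℝ) + 1) / n) (by positivity)
      rw [Real.log_div (by positivity) hn0.ne', add_div, div_self hn0.ne'] at h
      linarith
    have h2 := mul_le_mul_of_nonneg_left h1 hn0.le
    rw [mul_add, mul_one_div_cancel hn0.ne'] at h2
    rw [Nat.factorial_succ, Nat.cast_mul, Real.log_mul (by positivity) (by positivity)]
    push_cast
    linarith

theorem log_mul_exp_div {N C : ℕ} (hC1 : 1 ≤ C) (hC : C ≤ N) :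
    Real.log (N * Real.exp 1 / C) = Real.log N + 1 - Real.log C := by
  have hC0 : (C : ℝ) ≠ 0 := by positivity
  have hN0 : (N : ℝ) ≠ 0 := by
    have : 0 < N := by omega
    positivity
  rw [Real.log_div (by positivity) hC0, Real.log_mul hN0 (Real.exp_pos 1).ne', Real.log_exp]

theorem one_le_mul_log {N C : ℕ} (hC1 : 1 ≤ C) (hC : C ≤ N) :
    1 ≤ (C : ℝ) * Real.log (N * Real.exp 1 / C) := by
  have h : Real.log C ≤ Real.log N := Real.log_le_log (by positivity) (by exact_mod_cast hC)
  have h1 : (1 : ℝ) ≤ C := by exact_mod_cast hC1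
  rw [log_mul_exp_div hC1 hC]
  nlinarith

theorem log_choose_nonneg {N C : ℕ} (hC : C ≤ N) : 0 ≤ Real.log (N.choose C) :=
  Real.log_nonneg (by exact_mod_cast Nat.choose_pos hC)

/-- From `N.choose C ≤ N ^ C / C!` and `C! ≥ e * (C / e) ^ C`; the factor `e` yields the slack `-1`
needed at the initial rate. -/
theorem log_choose_le {N C : ℕ} (hC1 : 1 ≤ C) (hC : C ≤ N) :
    Real.log (N.choose C) ≤ C * Real.log (N * Real.exp 1 / C) - 1 := by
  have h1 := Real.log_le_log (choose_cast_pos hC) (Nat.choose_le_pow_div (α := ℝ) C N)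
  have hN0 : (N : ℝ) ≠ 0 := by
    have : 0 < N := by omega
    positivity
  rw [Real.log_div (by positivity) (by positivity), Real.log_pow] at h1
  have h2 := log_factorial_ge hC1
  rw [log_mul_exp_div hC1 hC]
  linarith

/-! ### The potential of Sage -/

section Potential

variable {N : ℕ}

/-- An upper bound for the total loss of Sage on requests with frequencies `R`. -/
noncomputable def sagePotential (C : ℕ) (D : ℝ) (R : Fin N → ℕ) : ℝ :=
  staticMisses C R + sageRegretBound C D (Real.log (N.choose C)) (staticMisses C R) -
    lossFactor (sageRate D (staticMisses C R)) * logExcess C (sageRate D (staticMisses C R)) R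

theorem sagePotential_le {C : ℕ} (hC : C ≤ N) {D : ℝ} (hD : 1 ≤ D) (R : Fin N → ℕ) :
    sagePotential C D R ≤ staticMisses C R +
      sageRegretBound C D (Real.log (N.choose C)) (staticMisses C R) := by
  have := mul_nonneg (lossFactor_pos (sageRate_pos hD (staticMisses C R))).le
    (logExcess_nonneg hC (sageRate D (staticMisses C R)) R)
  unfold sagePotential
  linarith

theorem sagePotential_zero_nonneg {C : ℕ} (hC : C ≤ N) {D : ℝ} (hD : 1 ≤ D) :
    0 ≤ sagePotential C D (0 : Fin N → ℕ) := by
  have h0 : staticMisses C (0 : Fin N → ℕ) = 0 := by simp [staticMisses]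
  have hlt : ((0 : ℕ) : ℝ) < D := by norm_num; linarith
  have hη := log_thousand_mul_pos hD
  rw [sagePotential, h0, sageRegretBound, sageRate, if_pos hlt, if_pos hlt]
  have := mul_le_mul_of_nonneg_left (logExcess_le hC hη.le (0 : Fin N → ℕ)) (lossFactor_pos hη).le
  simp
  linarith

theorem one_sub_sageMarginal_le {C : ℕ} (hC1 : 1 ≤ C) (hC : C ≤ N) {D : ℝ} (hD : 1 ≤ D)
    (hlam : Real.log (N.choose C) ≤ D - 1) (R : Fin N → ℕ) (i : Fin N) :
    1 - sageMarginal C (sageRate D (staticMisses C R)) R i ≤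
      sagePotential C D (addRequest R i) - sagePotential C D R := by
  set l := staticMisses C R with hl
  set η := sageRate D l with hη_def
  have hη : 0 < η := sageRate_pos hD l
  have hκ := lossFactor_pos hη
  have hp0 := sageMarginal_nonneg (C := C) η R i
  have hp1 := sageMarginal_le_one hC1 hC η R i
  have hself := sageMarginal_addRequest_self hC1 hC η R i
  have hX := logExcess_addRequest hC1 hC hη.le R i
  have he : 0 < Real.exp η - 1 := by linarith [Real.add_one_lt_exp hη.ne']
  set p := sageMarginal C η R i with hp
  have hP : 0 < 1 + p * (Real.exp η - 1) := by positivity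
  have hsum := sum_addRequest R i Finset.univ
  rw [if_pos (Finset.mem_univ i)] at hsum
  have hm := staticMisses_add_staticHits C R
  have hm' := staticMisses_add_staticHits C (addRequest R i)
  have hle := staticHits_le_addRequest hC R i
  have hle' := staticHits_addRequest_le hC R i
  rcases hle.eq_or_lt with heq | hlt
  · have hl' : staticMisses C (addRequest R i) = l + 1 := by omega
    -- The new marginal is at most `C / (C + 1)`; the identity `hself` turns this into a condition
    -- on the old one.
    have hP2 : 1 + p * (Real.exp η - 1) ≤ (C + 1) * (1 - p) := by
      have h1 := sageMarginal_le_of_staticHits_eq hC1 hC hη.le heq.symm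
      have h2 : 1 ≤ ((C : ℝ) + 1) * (1 - sageMarginal C η (addRequest R i) i) := by linarith
      have h3 := mul_le_mul_of_nonneg_right h2 hP.le
      rw [mul_assoc, hself] at h3
      linarith
    have hX0 := logExcess_nonneg hC η R
    rw [← heq, sub_self, mul_zero, sub_zero] at hX
    rw [sagePotential, sagePotential, hl', ← hl, ← hη_def]
    set η' := sageRate D (l + 1) with hη_def'
    have hη' : 0 < η' := sageRate_pos hD (l + 1)
    push_cast
    rcases sageRegretBound_step hC1 hD (log_choose_nonneg hC) hlam l with hstep | ⟨hηη, hstep⟩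
    · have h1 := mul_le_mul_of_nonneg_left (logExcess_le hC hη'.le (addRequest R i))
        (lossFactor_pos hη').le
      have h2 := mul_nonneg hκ.le hX0
      linarith
    · have hs := hstep p hp0 hP2
      rw [← hη_def, ← hη_def', mixGap] at hs
      have h1 := mul_le_mul_of_nonneg_left (logExcess_le_of_le hC hη' hηη (addRequest R i))
        (lossFactor_pos hη').le
      have h2 := mul_le_mul_of_nonneg_right (lossFactor_mul_div_le hη' hηη)
        (logExcess_nonneg hC η (addRequest R i))
      rw [hX] at h1 h2
      linarith
  · have hl' : staticMisses C (addRequest R i) = l := by omega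
    have hG : (staticHits C (addRequest R i) : ℝ) - staticHits C R = 1 := by
      have : staticHits C (addRequest R i) = staticHits C R + 1 := by omega
      rw [this]
      push_cast
      ring
    rw [hG, mul_one] at hX
    rw [sagePotential, sagePotential, hl', ← hl, ← hη_def, hX]
    -- The best set gained a hit, so `l`, the rate and `b` stay fixed, and the fall of `X` alone
    -- must pay for the loss `1 - p`.
    have hlog := Real.log_le_sub_one_of_pos
      (x := (1 + p * (Real.exp η - 1)) * Real.exp (-η)) (by positivity)
    rw [Real.log_mul hP.ne' (Real.exp_pos _).ne', Real.log_exp] at hlog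
    have hee : Real.exp η * Real.exp (-η) = 1 := by rw [← Real.exp_add]; simp
    have h2 : (1 - p) * (1 - Real.exp (-η)) ≤ η - Real.log (1 + p * (Real.exp η - 1)) := by
      linear_combination hlog + p * hee
    have h3 := mul_le_mul_of_nonneg_left h2 hκ.le
    have h4 : lossFactor η * ((1 - p) * (1 - Real.exp (-η))) = 1 - p := by
      have := one_sub_exp_neg_pos hη
      rw [lossFactor]; field_simp
    rw [h4] at h3
    linarith

end Potential

/-! ### Copies of Sage driven by a sequence of states -/

section States

variable {N : ℕ} {σ : Type*} [DecidableEq σ] (s : ℕ → σ) (x : ℕ → Fin N)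

theorem stateCounts_zero (a : σ) : stateCounts s x 0 a = 0 := by
  funext i
  simp [stateCounts]

theorem stateCounts_succ_self (t : ℕ) :
    stateCounts s x (t + 1) (s t) = addRequest (stateCounts s x t (s t)) (x t) := by
  funext i
  rw [stateCounts, Finset.range_add_one, Finset.filter_insert, addRequest, stateCounts]
  by_cases h : x t = i
  · rw [if_pos ⟨rfl, h⟩, if_pos h.symm, Finset.card_insert_of_notMem (by simp)]
  · rw [if_neg fun h' => h h'.2, if_neg (Ne.symm h), add_zero]

theorem stateCounts_succ_of_ne {t : ℕ} {a : σ} (h : a ≠ s t) :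
    stateCounts s x (t + 1) a = stateCounts s x t a := by
  funext i
  rw [stateCounts, Finset.range_add_one, Finset.filter_insert, if_neg fun h' => h h'.1.symm,
    stateCounts]

theorem stateCounts_ne_zero_iff {T : ℕ} {a : σ} {i : Fin N} :
    stateCounts s x T a i ≠ 0 ↔ ∃ t < T, s t = a ∧ x t = i := by
  rw [stateCounts, Finset.card_ne_zero, Finset.filter_nonempty_iff]
  simp only [Finset.mem_range]

/-- Telescoping: a round changes the potential only of the state in which it is spent. -/
theorem sum_one_sub_sageHitProb_le {C : ℕ} (hC1 : 1 ≤ C) (hC : C ≤ N) {D : ℝ} (hD : 1 ≤ D)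
    (hlam : Real.log (N.choose C) ≤ D - 1) {A : Finset σ} (T : ℕ) (hA : ∀ t < T, s t ∈ A) :
    ∑ t ∈ Finset.range T,
        (1 - sageHitProb C (sageRate D) (stateCounts s x t (s t)) (x t)) ≤
      ∑ a ∈ A, (sagePotential C D (stateCounts s x T a) - sagePotential C D (0 : Fin N → ℕ)) := by
  induction T with
  | zero => simp [stateCounts_zero]
  | succ t ih =>
    have ih := ih fun τ hτ => hA τ (hτ.trans (Nat.lt_succ_self t))
    have hst := hA t (Nat.lt_succ_self t)
    rw [Finset.sum_range_succ, ← Finset.add_sum_erase A _ hst]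
    rw [← Finset.add_sum_erase A _ hst] at ih
    have h1 : ∑ a ∈ A.erase (s t), (sagePotential C D (stateCounts s x (t + 1) a) -
        sagePotential C D (0 : Fin N → ℕ)) = ∑ a ∈ A.erase (s t),
        (sagePotential C D (stateCounts s x t a) - sagePotential C D (0 : Fin N → ℕ)) :=
      Finset.sum_congr rfl fun a ha => by
        rw [stateCounts_succ_of_ne s x (Finset.mem_erase.1 ha).1]
    have h2 := one_sub_sageMarginal_le hC1 hC hD hlam (stateCounts s x t (s t)) (x t)
    rw [h1, stateCounts_succ_self, sageHitProb_eq hC1 hC]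
    linarith

theorem staticMisses_stateCounts_le {C : ℕ} {S : Finset (Fin N)} (hS : S.card = C) (T : ℕ)
    (a : σ) : staticMisses C (stateCounts s x T a) ≤
      ((Finset.range T).filter fun t => x t ∉ S ∧ s t = a).card := by
  have h1 := staticMisses_add_staticHits C (stateCounts s x T a)
  have h2 := sum_le_staticHits hS (stateCounts s x T a)
  have h3 := Finset.sum_add_sum_compl S (stateCounts s x T a)
  have h4 : ∑ i ∈ Sᶜ, stateCounts s x T a i =
      ((Finset.range T).filter fun t => x t ∉ S ∧ s t = a).card := by
    rw [Finset.card_eq_sum_card_fiberwise (f := x) (t := Sᶜ)]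
    · refine Finset.sum_congr rfl fun i hi => ?_
      rw [stateCounts, Finset.filter_filter]
      refine congrArg Finset.card (Finset.filter_congr fun t _ => ?_)
      rw [Finset.mem_compl] at hi
      constructor
      · rintro ⟨h, rfl⟩
        exact ⟨⟨hi, h⟩, rfl⟩
      · rintro ⟨⟨-, h⟩, h'⟩
        exact ⟨h, h'⟩
    · intro t ht
      simpa using (Finset.mem_filter.1 ht).2.1
  omega

theorem sum_staticMisses_le_bestMissCount {C : ℕ} (hC : C ≤ N) (T : ℕ) (A : Finset σ) :
    ∑ a ∈ A, staticMisses C (stateCounts s x T a) ≤ bestMissCount C s x T := by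
  obtain ⟨f, hf, h⟩ := exists_bestMissCount x hC s T
  rw [h, missCount]
  calc ∑ a ∈ A, staticMisses C (stateCounts s x T a)
      ≤ ∑ a ∈ A, (((Finset.range T).filter fun t => x t ∉ f (s t)).filter
          fun t => s t = a).card := by
        refine Finset.sum_le_sum fun a _ => ?_
        refine (staticMisses_stateCounts_le s x (hf a) T a).trans_eq ?_
        rw [Finset.filter_filter]
        refine congrArg Finset.card (Finset.filter_congr fun t _ => ?_)
        constructor
        · rintro ⟨h, rfl⟩
          exact ⟨h, rfl⟩
        · rintro ⟨h, rfl⟩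
          exact ⟨h, rfl⟩
    _ ≤ _ := by
        rw [Finset.sum_card_fiberwise_eq_card_filter]
        exact Finset.card_filter_le _ _

end States

/-! ### The regret of the LZ prefetcher -/

theorem sageRegretBound_le_of_requested {N C : ℕ} (hC1 : 1 ≤ C) (hC : C ≤ N) {D lam : ℝ}
    (hD : 1 ≤ D) (hlam : lam ≤ D - 1) {R : Fin N → ℕ} (hR : ∃ i, R i ≠ 0) :
    sageRegretBound C D lam (staticMisses C R) ≤
      (Finset.univ.filter fun i => R i ≠ 0).card * D +
        √(2 * (Finset.univ.filter fun i => R i ≠ 0).card) * √(D * staticMisses C R) := by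
  set n := (Finset.univ.filter fun i => R i ≠ 0).card with hn
  have hn1 : 1 ≤ n := Finset.card_pos.2 ⟨hR.choose, by simpa using hR.choose_spec⟩
  rcases Nat.eq_zero_or_pos (staticMisses C R) with h0 | hpos
  · rw [h0]
    have h1 : (1 : ℝ) ≤ n := by exact_mod_cast hn1
    refine (sageRegretBound_zero_le hD hlam).trans ?_
    simp
    nlinarith
  · have hCn : C + 1 ≤ n := by
      by_contra h
      have := staticMisses_eq_zero_of_card_le hC (R := R) (by omega)
      omega
    have h1 : (C : ℝ) + 1 ≤ n := by exact_mod_cast hCn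
    refine (sageRegretBound_le hC1 hD hlam _).trans ?_
    gcongr

theorem lz_regret_le {N C : ℕ} (hC1 : 1 ≤ C) (hC : C ≤ N) (x : ℕ → Fin N) (T : ℕ) :
    (T : ℝ) - sageExpectedHits C (sageRate (C * Real.log (N * Real.exp 1 / C))) (lzNode x) x T ≤
      lzBestMisses C x T + regretTerm N C (lzNodeCount x T) (lzBestMisses C x T) := by
  have hD := one_le_mul_log hC1 hC
  have hlam := log_choose_le hC1 hC
  set D := (C : ℝ) * Real.log (N * Real.exp 1 / C) with hD_def
  have hD0 : 0 ≤ D := by linarith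
  let A := (Finset.range T).image (lzNode x)
  let R : List (Fin N) → Fin N → ℕ := fun a => stateCounts (lzNode x) x T a
  let n : List (Fin N) → ℕ := fun a => (Finset.univ.filter fun i => R a i ≠ 0).card
  have hn : ∑ a ∈ A, n a ≤ lzNodeCount x T := by
    have h := sum_card_requested_le_lzNodeCount x T A
    simp_rw [← stateCounts_ne_zero_iff (lzNode x) x] at h
    exact h
  have hL : ∑ a ∈ A, staticMisses C (R a) ≤ lzBestMisses C x T :=
    sum_staticMisses_le_bestMissCount (lzNode x) x hC T A
  have hn' : ∑ a ∈ A, (n a : ℝ) ≤ lzNodeCount x T := by exact_mod_cast hn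
  have hL' : ∑ a ∈ A, (staticMisses C (R a) : ℝ) ≤ lzBestMisses C x T := by exact_mod_cast hL
  have h1 := sum_one_sub_sageHitProb_le (lzNode x) x hC1 hC hD hlam (A := A) T fun t ht =>
    Finset.mem_image_of_mem _ (Finset.mem_range.2 ht)
  have h2 : ∀ a ∈ A, sagePotential C D (R a) - sagePotential C D (0 : Fin N → ℕ) ≤
      staticMisses C (R a) + (n a * D + √(2 * n a) * √(D * staticMisses C (R a))) := by
    intro a ha
    obtain ⟨t, ht, hta⟩ := Finset.mem_image.1 ha
    have h := sageRegretBound_le_of_requested hC1 hC hD hlam (R := R a)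
      ⟨x t, (stateCounts_ne_zero_iff (lzNode x) x).2 ⟨t, Finset.mem_range.1 ht, hta, rfl⟩⟩
    have h' := sagePotential_le hC hD (R a)
    have h0 := sagePotential_zero_nonneg hC hD
    linarith
  have h3 := h1.trans (Finset.sum_le_sum h2)
  rw [Finset.sum_add_distrib, Finset.sum_add_distrib, ← Finset.sum_mul] at h3
  -- Cauchy–Schwarz over the visited nodes, followed by the bounds on the totals of `n` and of the
  -- static misses.
  have h4 : ∑ a ∈ A, √(2 * n a) * √(D * staticMisses C (R a)) ≤
      √(2 * lzNodeCount x T) * √(D * lzBestMisses C x T) := by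
    refine (Real.sum_sqrt_mul_sqrt_le A (fun a => by positivity) (fun a => by positivity)).trans ?_
    rw [← Finset.mul_sum, ← Finset.mul_sum]
    gcongr
  have h5 : (∑ a ∈ A, (n a : ℝ)) * D ≤ lzNodeCount x T * D := by gcongr
  have h6 : √(2 * lzNodeCount x T) * √(D * lzBestMisses C x T) =
      √(2 * lzNodeCount x T * C * lzBestMisses C x T * Real.log (N * Real.exp 1 / C)) := by
    rw [← Real.sqrt_mul (by positivity), hD_def]
    ring_nf
  have h7 : ∑ t ∈ Finset.range T, (1 - sageHitProb C (sageRate D)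
      (stateCounts (lzNode x) x t (lzNode x t)) (x t)) =
      T - sageExpectedHits C (sageRate D) (lzNode x) x T := by
    rw [Finset.sum_sub_distrib, sageExpectedHits]
    simp
  rw [h7] at h3
  rw [h6] at h4
  unfold regretTerm
  have h8 : (C : ℝ) * lzNodeCount x T * Real.log (N * Real.exp 1 / C) = lzNodeCount x T * D := by
    rw [hD_def]; ring
  linarith

theorem markovHitRate_sub_lzHitRate_le {N C : ℕ} (hC1 : 1 ≤ C) (hC : C ≤ N) (x : ℕ → Fin N)
    (T k : ℕ) :
    (T : ℝ) * (markovHitRate C k x T -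
        lzHitRate C (sageRate (C * Real.log (N * Real.exp 1 / C))) x T) ≤
      regretTerm N C (lzNodeCount x T) (lzBestMisses C x T) + k * lzNodeCount x T := by
  -- For `T = 0` the rates are `0` by the convention for division, so the numerators must vanish as
  -- well.
  have hmul : ∀ y : ℝ, (T = 0 → y = 0) → (T : ℝ) * (y / T) = y := by
    intro y hy
    rcases Nat.eq_zero_or_pos T with h | h
    · rw [hy h]; simp
    · field_simp
  have h1 : ((bestMarkovHits C k x T + lzBestMisses C x T : ℕ) : ℝ) ≤
      ((T + k * lzNodeCount x T : ℕ) : ℝ) := by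
    exact_mod_cast bestMarkovHits_le x hC k T
  have h2 := lz_regret_le hC1 hC x T
  push_cast at h1
  rw [mul_sub, markovHitRate, lzHitRate, hmul, hmul]
  · linarith
  · rintro rfl
    simp [sageExpectedHits]
  · rintro rfl
    have : bestMarkovHits C k x 0 = 0 := by
      rw [bestMarkovHits, ← Nat.bot_eq_zero, eq_bot_iff]
      refine csSup_le' ?_
      rintro _ ⟨s₀, f, -, rfl⟩
      simp [hitCount]
    rw [this, Nat.cast_zero]

end UniversalCaching

open UniversalCaching
theorem theorem3 :
    (∀ N C : ℕ, 1 ≤ C → C ≤ N →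
      ∃ rate : ℕ → ℝ, (∀ l, 0 < rate l) ∧
        ∀ (x : ℕ → Fin N) (T k : ℕ),
          (T : ℝ) * (markovHitRate C k x T - lzHitRate C rate x T) ≤
            regretTerm N C (lzNodeCount x T) (lzBestMisses C x T) + k * lzNodeCount x T) ∧
    (∃ A : ℝ, 0 < A ∧
      ∀ N : ℕ, 2 ≤ N → ∀ (x : ℕ → Fin N) (T : ℕ), 2 ≤ T →
        (lzNodeCount x T : ℝ) ≤ A * (T * Real.log N / Real.log T)) :=
  ⟨fun _ _ hC1 hC => ⟨_, fun l => sageRate_pos (one_le_mul_log hC1 hC) l,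
    fun x T k => markovHitRate_sub_lzHitRate_le hC1 hC x T k⟩,
    6, by norm_num, fun _ hN x _ hT => lzNodeCount_le hN x hT⟩
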